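/- By a chain cover of a topological space $X$ we mean a cover of $X$ by open sets that is linearly ordered by inclusion; $X$ is linearly H-closed if every chain cover of $X$ has a member that is dense in $X$. There are linearly H-closed non-compact Hausdorff spaces in each of the following classes. (a) (Bell) There is a linearly H-closed, non-compact, first countable, Tychonoff space with Lindelöf number $\omega_1$. (The Lindelöf number of $X$ is the least cardinal $\kappa$ such that every open cover of $X$ has a subcover of cardinality at most $\kappa$.) (b) (Isbell) For every infinite maximal almost disjoint family $\mathcal A$ of infinite subsets of $\mathbb N$, the space $\Psi(\mathcal A)=\mathbb N\sqcup\mathcal A$ is linearly H-closed, non-compact, first countable, locally compact, Tychonoff, and perfect (every closed set is a $G_\delta$); and such families $\mathcal A$ exist. In $\Psi(\mathcal A)$ the points of $\mathbb N$ are isolated, and the basic neighbourhoods of $A\in\mathcal A$ are the sets $\{A\}\cup(A\setminus F)$ with $F$ finite. (c) (Franklin and Rajagopalan, in effect) If $\mathfrak p=\omega_1$, there is a linearly H-closed, non-compact, first countable, locally compact, normal Hausdorff space. Here $\mathfrak p$ is the least cardinality of a family of subsets of $\mathbb N$ all of whose finite subfamilies have infinite intersection, but for which there is no infinite $P\subseteq\mathbb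 N$ with $P\setminus A$ finite for all members $A$ of the family. (d) (Ostaszewski) If $\diamondsuit$ holds, there is a linearly H-closed, non-compact, first countable, locally compact, perfectly normal Hausdorff space. Here $\diamondsuit$ says that there are sets $A_\alpha\subseteq\alpha$ $(\alpha<\omega_1)$ such that for every $S\subseteq\omega_1$ the set $\{\alpha<\omega_1: S\cap\alpha=A_\alpha\}$ is stationary in $\omega_1$. (e) The $\Sigma$-product in $2^{\omega_1}$, that is, the subspace of the product space $\{0,1\}^{\omega_1}$ of all points at most countably many of whose coordinates have value $1$, is linearly H-closed, non-compact, Fréchet–Urysohn, and collectionwise normal (it is Hausdorff and, for every discrete collection of closed sets, there are pairwise disjoint open sets each containing the corresponding member of the collection). -/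

import Mathlib

open scoped Cardinal Ordinal

universe u

/-- A chain cover: a cover of the space by open sets that is linearly ordered by inclusion. -/
def IsChainCover {X : Type u} [TopologicalSpace X] (𝒰 : Set (Set X)) : Prop :=
  (∀ U ∈ 𝒰, IsOpen U) ∧ ⋃₀ 𝒰 = Set.univ ∧ IsChain (· ⊆ ·) 𝒰

/-- A space is linearly H-closed if every chain cover has a member which is dense. -/
def LinearlyHClosed (X : Type u) [TopologicalSpace X] : Prop :=
  ∀ 𝒰 : Set (Set X), IsChainCover 𝒰 → ∃ U ∈ 𝒰, Dense U

/-- A space is perfect if every closed subset is a `Gδ`. -/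
def ClosedSetsAreGδ (X : Type u) [TopologicalSpace X] : Prop :=
  ∀ F : Set X, IsClosed F → IsGδ F

/-- The Lindelöf number `L(X)`: the least cardinal `κ` such that every open cover of `X` has a
subcover of cardinality at most `κ`. -/
noncomputable def lindelofNumber (X : Type u) [TopologicalSpace X] : Cardinal.{u} :=
  sInf {κ : Cardinal.{u} | ∀ 𝒰 : Set (Set X), (∀ U ∈ 𝒰, IsOpen U) → ⋃₀ 𝒰 = Set.univ →
    ∃ 𝒱 : Set (Set X), 𝒱 ⊆ 𝒰 ∧ ⋃₀ 𝒱 = Set.univ ∧ #𝒱 ≤ κ}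

/-- A collection of subsets is discrete if every point has a neighbourhood which meets at most one
member of the collection. -/
def IsDiscreteCollection {X : Type u} [TopologicalSpace X] (𝓕 : Set (Set X)) : Prop :=
  ∀ x : X, ∃ N ∈ nhds x, {F ∈ 𝓕 | (F ∩ N).Nonempty}.Subsingleton

/-- A Hausdorff space is collectionwise normal if the members of every discrete collection of
closed sets can be enlarged to pairwise disjoint open sets. -/
structure CollectionwiseNormal (X : Type u) [TopologicalSpace X] : Prop where
  t2 : T2Space X
  separate : ∀ 𝓕 : Set (Set X), (∀ F ∈ 𝓕, IsClosed F) → IsDiscreteCollection 𝓕 →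
    ∃ U : Set X → Set X, (∀ F ∈ 𝓕, IsOpen (U F) ∧ F ⊆ U F) ∧ 𝓕.PairwiseDisjoint U

/-- A family of infinite subsets of `ℕ`, any two distinct members of which have finite
intersection. -/
def IsAlmostDisjoint (𝒜 : Set (Set ℕ)) : Prop :=
  (∀ A ∈ 𝒜, A.Infinite) ∧ ∀ A ∈ 𝒜, ∀ B ∈ 𝒜, A ≠ B → (A ∩ B).Finite

/-- An infinite family which is maximal (for inclusion) among the almost disjoint families of
infinite subsets of `ℕ`. -/
def IsInfiniteMAD (𝒜 : Set (Set ℕ)) : Prop :=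
  𝒜.Infinite ∧ Maximal IsAlmostDisjoint 𝒜

/-- The underlying set of the space `Ψ(𝒜)`: the disjoint union of `ℕ` and `𝒜`. -/
def IsbellPsi (𝒜 : Set (Set ℕ)) : Type := ℕ ⊕ 𝒜

/-- The topology of `Ψ(𝒜)`: the points of `ℕ` are isolated, and the basic neighbourhoods of a
point `A ∈ 𝒜` consist of that point together with all but finitely many elements of the set `A`. -/
instance (𝒜 : Set (Set ℕ)) : TopologicalSpace (IsbellPsi 𝒜) where
  IsOpen U := ∀ A : 𝒜, (Sum.inr A : ℕ ⊕ 𝒜) ∈ (show Set (ℕ ⊕ 𝒜) from U) →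
    {n ∈ (A : Set ℕ) | (Sum.inl n : ℕ ⊕ 𝒜) ∉ (show Set (ℕ ⊕ 𝒜) from U)}.Finite
  isOpen_univ := fun A _ => by
    refine Set.finite_empty.subset ?_
    rintro n ⟨-, hn⟩
    exact (hn trivial).elim
  isOpen_inter := fun U V hU hV A hA => by
    refine ((hU A hA.1).union (hV A hA.2)).subset ?_
    rintro n ⟨hnA, hn⟩
    by_cases h : (Sum.inl n : ℕ ⊕ 𝒜) ∈ (show Set (ℕ ⊕ 𝒜) from U)
    · exact Or.inr ⟨hnA, fun h' => hn ⟨h, h'⟩⟩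
    · exact Or.inl ⟨hnA, h⟩
  isOpen_sUnion := fun 𝒰 h A hA => by
    obtain ⟨U, hU, hAU⟩ := hA
    refine (h U hU A hAU).subset ?_
    rintro n ⟨hnA, hn⟩
    exact ⟨hnA, fun h' => hn ⟨U, hU, h'⟩⟩

/-- The cardinal `𝔭`: the least cardinality of a family of subsets of `ℕ` such that every finite
subfamily has infinite intersection, but no infinite set is almost contained in all members. -/
noncomputable def pseudointersectionNumber : Cardinal.{0} :=
  sInf {κ : Cardinal.{0} | ∃ 𝓕 : Set (Set ℕ), #𝓕 = κ ∧
    (∀ 𝓖 ⊆ 𝓕, 𝓖.Finite → (⋂₀ 𝓖).Infinite) ∧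
    ¬ ∃ P : Set ℕ, P.Infinite ∧ ∀ A ∈ 𝓕, (P \ A).Finite}

/-- The axiom `◇`: there are sets `A α ⊆ α`, for `α < ω₁`, such that for every `S ⊆ ω₁` the set
of those `α` with `S ∩ α = A α` is stationary in `ω₁`. -/
def DiamondPrinciple : Prop :=
  ∃ A : (ω₁ : Ordinal.{0}).ToType → Set (ω₁ : Ordinal.{0}).ToType,
    (∀ α, A α ⊆ Set.Iio α) ∧
    ∀ S : Set (ω₁ : Ordinal.{0}).ToType, IsStationary {α | S ∩ Set.Iio α = A α}

/-- The `Σ`-product in `2^I`: the points of `2^I` at most countably many of whose coordinates have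
value `1`. It carries the subspace topology of the product topology. -/
def SigmaProduct (I : Type u) : Set (I → Bool) :=
  {x | {i | x i = true}.Countable}

section

open Set Filter Topology

/-! ### General topology -/

/-! Linear H-closedness always comes from one criterion: every open cover has a countable subfamily
with dense union, and every sequence of nonempty open sets clusters at a point. If no member of a
chain cover is dense, such a subfamily is cofinal in the chain, and the complements of the closures
of its growing members cannot cluster anywhere.

(a) and (c) share a space of Franklin–Rajagopalan type. The ordinals below ω₁ are attached to ℕ × K,
with K compact and first countable, along sequences of clopen sets `V α n` that increase in α modulo
finitely many n. Each point of K lies in all `V β n` for β large, so a sequence that leaves the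
copies of K clusters at the least α whose sets catch it infinitely often. A closed set with bounded
ordinals is compact, and two closed sets with unbounded ordinals meet; this gives normality. K is
the path space of the Aronszajn tree of finite modifications of a coherent sequence of finite-to-one
functions. No path meets all levels, so countably many nodes determine it; `V α n` consists of the
paths that avoid a finite set of nodes at level α.

(d) The space ω₁ × ℕ is topologized level by level. A set guessed by level α either accumulates at
all points of that level or is covered by finitely many compact sets, and accumulation at a whole
level persists upwards. Under ◇, countable closed sets are compact and uncountable closed sets are
co-countable.

(b) By maximality, every infinite set of integers clusters at a member of 𝒜. (e) Closing off
countable sets of coordinates reduces the claims to compact subspaces with countably many active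
coordinates. -/

theorem linearlyHClosed_of_weaklyLindelof_of_feeblyCompact {X : Type u} [TopologicalSpace X]
    [Nonempty X]
    (hW : ∀ 𝒰 : Set (Set X), (∀ U ∈ 𝒰, IsOpen U) → ⋃₀ 𝒰 = univ →
      ∃ 𝒱 ⊆ 𝒰, 𝒱.Countable ∧ Dense (⋃₀ 𝒱))
    (hF : ∀ V : ℕ → Set X, (∀ n, IsOpen (V n)) → (∀ n, (V n).Nonempty) →
      ∃ x, ∀ N ∈ 𝓝 x, ∃ᶠ n in atTop, (V n ∩ N).Nonempty) :
    LinearlyHClosed X := by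
  rintro 𝒰 ⟨hopen, hcov, hchain⟩
  by_contra! hnd
  obtain ⟨𝒱, h𝒱, hc, hd⟩ := hW 𝒰 hopen hcov
  have hne : 𝒱.Nonempty := by
    obtain ⟨x, U, hU, -⟩ := hd.nonempty
    exact ⟨U, hU⟩
  obtain ⟨v, rfl⟩ := hc.exists_eq_range hne
  have hv : ∀ n, v n ∈ 𝒰 := fun n => h𝒱 ⟨n, rfl⟩
  -- If `U` lies in no `v n`, the chain condition puts every `v n` inside `U`, and `U` is dense.
  have hcof : ∀ U ∈ 𝒰, ∃ n, U ⊆ v n := by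
    intro U hU
    by_contra! hcon
    refine hnd U hU (hd.mono ?_)
    rintro x ⟨_, ⟨n, rfl⟩, hx⟩
    rcases hchain.total hU (hv n) with h | h
    · exact (hcon n h).elim
    · exact h hx
  have hmax : ∀ n, ∃ w ∈ 𝒰, ∀ i ≤ n, v i ⊆ w := by
    intro n
    induction n with
    | zero => exact ⟨v 0, hv 0, fun i hi => by rw [Nat.le_zero.1 hi]⟩
    | succ n ih =>
      obtain ⟨w, hw, hi⟩ := ih
      rcases hchain.total hw (hv (n + 1)) with h | h
      · refine ⟨v (n + 1), hv _, fun i hin => ?_⟩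
        rcases Nat.le_succ_iff.1 hin with h' | rfl
        · exact (hi i h').trans h
        · exact Subset.rfl
      · refine ⟨w, hw, fun i hin => ?_⟩
        rcases Nat.le_succ_iff.1 hin with h' | rfl
        · exact hi i h'
        · exact h
  choose w hw hwv using hmax
  obtain ⟨x, hx⟩ := hF (fun n => (closure (w n))ᶜ) (fun n => isClosed_closure.isOpen_compl)
    (fun n => by
      rw [nonempty_compl]
      intro h
      exact hnd _ (hw n) (dense_iff_closure_eq.2 h))
  obtain ⟨U, hU, hxU⟩ : x ∈ ⋃₀ 𝒰 := hcov ▸ mem_univ x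
  obtain ⟨k, hk⟩ := hcof U hU
  obtain ⟨n, hn, y, hy, hyk⟩ :=
    frequently_atTop.1 (hx (v k) ((hopen _ (hv k)).mem_nhds (hk hxU))) k
  exact hy (subset_closure (hwv n k hn hyk))

/-- A set is compact as soon as it is compact away from every neighbourhood of one of its points. -/
theorem isCompact_of_isCompact_diff {X : Type u} [TopologicalSpace X] {s : Set X} (p : X)
    (h : ∀ U, IsOpen U → p ∈ U → ∃ t, IsCompact t ∧ s \ U ⊆ t ∧ t ⊆ s) (hp : p ∈ s) :
    IsCompact s := by
  rw [isCompact_iff_finite_subcover]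
  intro ι V hV hs
  obtain ⟨i, hi⟩ := mem_iUnion.1 (hs hp)
  obtain ⟨t, ht, hst, hts⟩ := h (V i) (hV i) hi
  obtain ⟨F, hF⟩ := ht.elim_finite_subcover V hV (hts.trans hs)
  classical
  refine ⟨insert i F, fun x hx => ?_⟩
  by_cases hxi : x ∈ V i
  · exact mem_biUnion (Finset.mem_insert_self i F) hxi
  · obtain ⟨j, hj, hxj⟩ := mem_iUnion₂.1 (hF (hst ⟨hx, hxi⟩))
    exact mem_biUnion (Finset.mem_insert_of_mem hj) hxj

/-- If one of two disjoint closed sets is always compact, then a regular space is normal. -/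
theorem normalSpace_of_isCompact_or {X : Type u} [TopologicalSpace X] [RegularSpace X]
    (h : ∀ s t : Set X, IsClosed s → IsClosed t → Disjoint s t → IsCompact s ∨ IsCompact t) :
    NormalSpace X := by
  refine ⟨fun s t hs ht hst => ?_⟩
  rcases h s t hs ht hst with h | h
  · exact SeparatedNhds.of_isCompact_isClosed h ht hst
  · exact (SeparatedNhds.of_isCompact_isClosed h hs hst.symm).symm

/-! ### The first uncountable ordinal as a type -/

/-- The well-ordered set `ω₁`. -/
abbrev Omega1 : Type := (ω₁ : Ordinal.{0}).ToType

namespace Omega1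

theorem mk_eq : #Omega1 = ℵ₁ := by simp [Omega1]

instance : Uncountable Omega1 := by
  rw [← Cardinal.aleph0_lt_mk_iff, mk_eq]
  exact Cardinal.aleph0_lt_aleph_one

theorem countable_Iio (a : Omega1) : (Iio a).Countable := by
  rw [← Cardinal.le_aleph0_iff_set_countable, ← Cardinal.lt_aleph_one_iff, ← mk_eq]
  exact Cardinal.mk_Iio_lt a (by rw [mk_eq, Cardinal.ord_aleph, Ordinal.type_toType])

theorem countable_Iic (a : Omega1) : (Iic a).Countable := by
  rw [← Iio_union_right]
  exact (countable_Iio a).union (countable_singleton a)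

theorem exists_gt_of_countable {s : Set Omega1} (hs : s.Countable) : ∃ b, ∀ a ∈ s, a < b := by
  by_contra! h
  refine not_countable_univ (α := Omega1) ((hs.biUnion fun a _ => countable_Iic a).mono ?_)
  intro b _
  obtain ⟨a, ha, hab⟩ := h b
  exact mem_biUnion ha hab

theorem exists_gt (a : Omega1) : ∃ b, a < b := by
  obtain ⟨b, hb⟩ := exists_gt_of_countable (countable_singleton a)
  exact ⟨b, hb a rfl⟩

theorem exists_isLUB_of_countable {s : Set Omega1} (hs : s.Countable) : ∃ b, IsLUB s b := by
  obtain ⟨b, hb⟩ := exists_gt_of_countable hs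
  have hne : (upperBounds s).Nonempty := ⟨b, fun a ha => (hb a ha).le⟩
  exact ⟨wellFounded_lt.min _ hne, wellFounded_lt.min_mem _ hne,
    fun c hc => not_lt.1 (wellFounded_lt.not_lt_min _ hc)⟩

end Omega1

/-! ### A coherent sequence of finite-to-one functions -/

namespace Omega1

theorem exists_injOn_Iio (a : Omega1) : ∃ g : Omega1 → ℕ, InjOn g (Iio a) :=
  countable_iff_exists_injOn.1 (countable_Iio a)

/-- The recursion behind a coherent sequence: `b α ξ` is an ordinal in `[ξ, α)`. -/
noncomputable def coherentAux (g : Omega1 → Omega1 → ℕ) (b : Omega1 → Omega1 → Omega1)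
    (hb : ∀ α ξ, ξ < α → b α ξ < α) (α ξ : Omega1) : ℕ :=
  open Classical in
  if _h : ξ < α then
    max (g α (b α ξ)) (if ξ = b α ξ then 0 else coherentAux g b hb (b α ξ) ξ)
  else 0
termination_by α
decreasing_by exact hb α ξ _h

/-- The functions are weights of walks: from `α` one steps to the point of `[ξ, α)` with least `g
α`-value, and so on down to `ξ`; `e α ξ` is the largest value met. -/
theorem exists_coherent : ∃ e : Omega1 → Omega1 → ℕ,
    (∀ α k, {ξ | ξ < α ∧ e α ξ ≤ k}.Finite) ∧
    ∀ α, ∀ β < α, {ξ | ξ < β ∧ e α ξ ≠ e β ξ}.Finite := by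
  choose g hg using exists_injOn_Iio
  have hex : ∀ α ξ : Omega1, ∃ b, ξ < α → b < α ∧ ξ ≤ b ∧ ∀ b' < α, ξ ≤ b' → g α b ≤ g α b' := by
    intro α ξ
    by_cases h : ξ < α
    · obtain ⟨b, ⟨h1, h2⟩, h3⟩ := exists_minimalFor_of_wellFoundedLT
        (fun b => b < α ∧ ξ ≤ b) (g α) ⟨ξ, h, le_rfl⟩
      refine ⟨b, fun _ => ⟨h1, h2, fun b' h4 h5 => ?_⟩⟩
      by_contra! h6
      exact absurd (h3 ⟨h4, h5⟩ h6.le) (not_le.2 h6)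
    · exact ⟨ξ, fun h' => absurd h' h⟩
  choose b hb using hex
  have hb1 : ∀ α ξ, ξ < α → b α ξ < α := fun α ξ h => (hb α ξ h).1
  set e := coherentAux g b hb1 with he
  have he1 : ∀ α ξ, ξ < α → e α ξ = max (g α (b α ξ)) (if ξ = b α ξ then 0 else e (b α ξ) ξ) := by
    intro α ξ h
    rw [he, coherentAux, dif_pos h]
  have hfin : ∀ α k, {β | β < α ∧ g α β ≤ k}.Finite := by
    intro α k
    refine Set.Finite.of_finite_image ((finite_Iic k).subset ?_) ((hg α).mono fun β hβ => hβ.1)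
    rintro _ ⟨β, hβ, rfl⟩
    exact hβ.2
  -- If `e α ξ ≤ k`, the first step lands in the finite set where `g α ≤ k`, and induction applies
  -- from there.
  have h1 : ∀ α k, {ξ | ξ < α ∧ e α ξ ≤ k}.Finite := by
    intro α
    induction α using WellFoundedLT.induction with
    | ind α ih =>
      intro k
      refine ((hfin α k).biUnion (t := fun β => {β} ∪ {ξ | ξ < β ∧ e β ξ ≤ k})
        fun β hβ => (finite_singleton β).union (ih β hβ.1 k)).subset ?_
      rintro ξ ⟨hξ, hk⟩
      rw [he1 α ξ hξ, max_le_iff] at hk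
      refine mem_biUnion (x := b α ξ) ⟨hb1 α ξ hξ, hk.1⟩ ?_
      by_cases h : ξ = b α ξ
      · exact Or.inl h
      · refine Or.inr ⟨lt_of_le_of_ne (hb α ξ hξ).2.1 h, ?_⟩
        simpa [h] using hk.2
  refine ⟨e, h1, ?_⟩
  intro α
  induction α using WellFoundedLT.induction with
  | ind α ih =>
    intro β hβ
    have hcoh : ∀ γ < α, {ξ | ξ < γ ∧ ξ < β ∧ e γ ξ ≠ e β ξ}.Finite := by
      intro γ hγ
      rcases lt_trichotomy γ β with h | rfl | h
      · exact (ih β hβ γ h).subset fun ξ hξ => ⟨hξ.1, hξ.2.2.symm⟩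
      · exact finite_empty.subset fun ξ hξ => hξ.2.2 rfl
      · exact (ih γ hγ β h).subset fun ξ hξ => hξ.2
    -- As `β` itself competes in `[ξ, α)`, the first step `γ` satisfies `g α γ ≤ g α β`, which
    -- leaves finitely many `γ`. For each, `e α ξ = e γ ξ` unless `ξ = γ` or `e γ ξ ≤ g α γ`, and `e
    -- γ` agrees with `e β` off a finite set.
    refine ((hfin α (g α β)).biUnion (t := fun γ => ({γ} ∪ {ξ | ξ < γ ∧ e γ ξ ≤ g α γ}) ∪
      {ξ | ξ < γ ∧ ξ < β ∧ e γ ξ ≠ e β ξ})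
        fun γ hγ => ((finite_singleton γ).union (h1 γ _)).union (hcoh γ hγ.1)).subset ?_
    rintro ξ ⟨hξ, hne⟩
    have hξα := hξ.trans hβ
    refine mem_biUnion (x := b α ξ) ⟨hb1 α ξ hξα, (hb α ξ hξα).2.2 β hβ hξ.le⟩ ?_
    by_cases h : ξ = b α ξ
    · exact Or.inl (Or.inl h)
    have hlt := lt_of_le_of_ne (hb α ξ hξα).2.1 h
    by_cases h2 : e (b α ξ) ξ ≤ g α (b α ξ)
    · exact Or.inl (Or.inr ⟨hlt, h2⟩)
    · refine Or.inr ⟨hlt, hξ, fun h3 => hne ?_⟩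
      rw [he1 α ξ hξα, if_neg h, max_eq_right (not_le.1 h2).le, h3]

end Omega1

/-! ### The path space of an Aronszajn tree -/

/-- A continuous map from a compact space to a Hausdorff space is closed, so neighbourhoods of a
value pull back to a neighbourhood base of the fibre. -/
theorem firstCountable_nhds_of_fiber {X Y : Type u} [TopologicalSpace X] [TopologicalSpace Y]
    [CompactSpace X] [T2Space Y] [FirstCountableTopology Y] {f : X → Y} (hf : Continuous f) (x : X)
    (hx : ∀ y, f y = f x → y = x) : (𝓝 x).IsCountablyGenerated := by
  have h := hf.isClosedMap.comap_nhds_eq hf (f x)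
  have h2 : f ⁻¹' {f x} = {x} := by
    ext y
    exact ⟨fun h => hx y h, fun h => congrArg f h⟩
  rw [h2, nhdsSet_singleton] at h
  rw [← h]
  infer_instance

namespace AronszajnPath

variable (e : Omega1 → Omega1 → ℕ)

/-- The functions which vanish off `α` and agree with `e α` on `α`, but for arguments and values
that `n` bounds. -/
def node (α : Omega1) (n : ℕ) : Set (Omega1 → ℕ) :=
  {v | (∀ ξ, α ≤ ξ → v ξ = 0) ∧ ∀ ξ < α, v ξ ≠ e α ξ → e α ξ ≤ n ∧ v ξ ≤ n}

/-- Restriction of a function to the ordinals below `β`. -/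
noncomputable def restrict (β : Omega1) (v : Omega1 → ℕ) : Omega1 → ℕ :=
  open Classical in fun ξ => if ξ < β then v ξ else 0

variable {e}

theorem node_mono {α : Omega1} {m n : ℕ} (h : m ≤ n) : node e α m ⊆ node e α n :=
  fun _ hv => ⟨hv.1, fun ξ hξ hne => ⟨(hv.2 ξ hξ hne).1.trans h, (hv.2 ξ hξ hne).2.trans h⟩⟩

theorem restrict_restrict {α β : Omega1} (h : β ≤ α) (v : Omega1 → ℕ) :
    restrict β (restrict α v) = restrict β v := by
  funext ξ
  by_cases hξ : ξ < β
  · simp [restrict, hξ, hξ.trans_le h]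
  · simp [restrict, hξ]

variable (he : ∀ α k, {ξ | ξ < α ∧ e α ξ ≤ k}.Finite)
  (hc : ∀ α, ∀ β < α, {ξ | ξ < β ∧ e α ξ ≠ e β ξ}.Finite)

include he in
-- A member is determined by its values on the finite set where `e α` is at most `n`, and these
-- values are at most `n`.
theorem finite_node (α : Omega1) (n : ℕ) : (node e α n).Finite := by
  have := (he α n).to_subtype
  let f : node e α n → ({ξ | ξ < α ∧ e α ξ ≤ n} → Fin (n + 1)) := fun v d =>
    ⟨v.1 d.1, by
      by_cases h : v.1 d.1 = e α d.1
      · rw [h]; exact Nat.lt_succ_of_le d.2.2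
      · exact Nat.lt_succ_of_le (v.2.2 _ d.2.1 h).2⟩
  have hf : Function.Injective f := by
    rintro ⟨v, hv⟩ ⟨w, hw⟩ h
    ext ξ
    rcases lt_or_ge ξ α with hξ | hξ
    · by_cases hn : e α ξ ≤ n
      · exact congrArg Fin.val (congrFun h ⟨ξ, hξ, hn⟩)
      · have h1 : v ξ = e α ξ := by
          by_contra h; exact hn (hv.2 ξ hξ h).1
        have h2 : w ξ = e α ξ := by
          by_contra h; exact hn (hw.2 ξ hξ h).1
        exact h1.trans h2.symm
    · exact (hv.1 ξ hξ).trans (hw.1 ξ hξ).symm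
  exact (Finite.of_injective f hf : Finite (node e α n))

include hc in
-- Below `β`, `e α` and `e β` differ at finitely many arguments; it suffices that `n` bounds both
-- functions there.
theorem exists_restrict_mem_node {α β : Omega1} (h : β < α) :
    ∃ m, ∀ n ≥ m, ∀ v ∈ node e α n, restrict β v ∈ node e β n := by
  obtain ⟨m1, hm1⟩ := ((hc α β h).image (e α)).bddAbove
  obtain ⟨m2, hm2⟩ := ((hc α β h).image (e β)).bddAbove
  refine ⟨max m1 m2, fun n hn v hv => ⟨fun ξ hξ => by simp [restrict, not_lt.2 hξ],
    fun ξ hξ hne => ?_⟩⟩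
  simp only [restrict, hξ, if_true] at hne ⊢
  by_cases h1 : e α ξ = e β ξ
  · have := hv.2 ξ (hξ.trans h) (by rwa [h1])
    rwa [h1] at this
  · have h2 : e α ξ ≤ n := (hm1 ⟨ξ, ⟨hξ, h1⟩, rfl⟩).trans ((le_max_left _ _).trans hn)
    have h3 : e β ξ ≤ n := (hm2 ⟨ξ, ⟨hξ, h1⟩, rfl⟩).trans ((le_max_right _ _).trans hn)
    refine ⟨h3, ?_⟩
    by_cases h4 : v ξ = e α ξ
    · rwa [h4]
    · exact (hv.2 ξ (hξ.trans h) h4).2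

variable (e) in
/-- The paths: downward closed chains of nodes. -/
def paths : Set (Omega1 × (Omega1 → ℕ) → Bool) :=
  {x | (∀ p, x p = true → ∃ n, p.2 ∈ node e p.1 n) ∧
    (∀ α v w, x (α, v) = true → x (α, w) = true → v = w) ∧
    ∀ α β v, β ≤ α → x (α, v) = true → x (β, restrict β v) = true}

theorem isClosed_paths : IsClosed (paths e) := by
  have hcl : ∀ p : Omega1 × (Omega1 → ℕ),
      IsClopen {x : Omega1 × (Omega1 → ℕ) → Bool | x p = true} := fun p =>
    (isClopen_discrete {true}).preimage (continuous_apply p)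
  have h : paths e = {x | ∀ p, x p = true → ∃ n, p.2 ∈ node e p.1 n} ∩
      ({x | ∀ α v w, x (α, v) = true → x (α, w) = true → v = w} ∩
        {x | ∀ α β v, β ≤ α → x (α, v) = true → x (β, restrict β v) = true}) := rfl
  rw [h]
  refine IsClosed.inter ?_ (IsClosed.inter ?_ ?_)
  · simp only [ofPred_forall]
    refine isClosed_iInter fun p => isClosed_imp (hcl p).isOpen isClosed_const
  · simp only [ofPred_forall]
    exact isClosed_iInter fun α => isClosed_iInter fun v => isClosed_iInter fun w =>
      isClosed_imp (hcl _).isOpen (isClosed_imp (hcl _).isOpen isClosed_const)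
  · simp only [ofPred_forall]
    exact isClosed_iInter fun α => isClosed_iInter fun β => isClosed_iInter fun v =>
      isClosed_iInter fun _ => isClosed_imp (hcl _).isOpen (hcl _).isClosed

instance : CompactSpace (paths e) := isCompact_iff_compactSpace.1 isClosed_paths.isCompact

include he in
-- This is the Aronszajn property. A path through all levels defines a function on ω₁ with an
-- uncountable fibre, say over `k`. An infinite countable part of this fibre lies below some `α`,
-- inside the finite set where `e α ≤ max n k`.
theorem exists_level_disjoint (x : paths e) : ∃ α, ∀ v, x.1 (α, v) = false := by
  by_contra! h
  simp only [ne_eq, Bool.not_eq_false] at h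
  choose v hv using h
  have hcoh : ∀ α β, β ≤ α → v β = restrict β (v α) := fun α β hβ =>
    x.2.2.1 β _ _ (hv β) (x.2.2.2 α β _ hβ (hv α))
  choose s hs using Omega1.exists_gt
  have hval : ∀ α, ∀ ξ < α, v α ξ = v (s ξ) ξ := by
    intro α ξ hξ
    rcases le_total α (s ξ) with h | h
    · rw [hcoh _ _ h]; simp [restrict, hξ]
    · rw [hcoh _ _ h]; simp [restrict, hs ξ]
  obtain ⟨k, hk⟩ : ∃ k, ¬ {ξ | v (s ξ) ξ = k}.Countable := by
    by_contra! hcon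
    refine not_countable_univ (α := Omega1) ((countable_iUnion hcon).mono fun ξ _ => ?_)
    exact mem_iUnion.2 ⟨_, rfl⟩
  have hinf : {ξ | v (s ξ) ξ = k}.Infinite := fun hf => hk hf.countable
  obtain ⟨t, ht, htinf, htc⟩ : ∃ t ⊆ {ξ | v (s ξ) ξ = k}, t.Infinite ∧ t.Countable := by
    refine ⟨range fun n => (hinf.natEmbedding _ n : Omega1), ?_, ?_, countable_range _⟩
    · rintro _ ⟨n, rfl⟩
      exact (hinf.natEmbedding _ n).2
    · exact infinite_range_of_injective
        (Subtype.val_injective.comp (hinf.natEmbedding _).injective)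
  obtain ⟨α, hα⟩ := Omega1.exists_gt_of_countable htc
  obtain ⟨n, hn⟩ := x.2.1 _ (hv α)
  refine htinf ((he α (max n k)).subset fun ξ hξ => ⟨hα ξ hξ, ?_⟩)
  by_cases h : v α ξ = e α ξ
  · rw [← h, hval α ξ (hα ξ hξ), ht hξ]
    exact le_max_right _ _
  · exact (hn.2 ξ (hα ξ hξ) h).1.trans (le_max_left _ _)

include he in
-- The path misses some level `α`, hence all higher ones. The countably many nodes of level at most
-- `α` single it out, since missing level `α` is visible on them.
theorem firstCountable_paths : FirstCountableTopology (paths e) := by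
  refine ⟨fun x => ?_⟩
  obtain ⟨α, hα⟩ := exists_level_disjoint he x
  let C : Set (Omega1 × (Omega1 → ℕ)) := ⋃ γ ∈ Iic α, ⋃ n, (fun v => (γ, v)) '' node e γ n
  have hC : C.Countable := (Omega1.countable_Iic α).biUnion fun γ _ =>
    countable_iUnion fun n => ((finite_node he γ n).image _).countable
  have := hC.to_subtype
  have hmem : ∀ y : paths e, ∀ γ v, γ ≤ α → y.1 (γ, v) = true → (γ, v) ∈ C := by
    intro y γ v hγ hy
    obtain ⟨n, hn⟩ := y.2.1 _ hy
    exact mem_biUnion hγ (mem_iUnion.2 ⟨n, v, hn, rfl⟩)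
  refine firstCountable_nhds_of_fiber (f := fun y : paths e => fun c : C => y.1 c)
    (continuous_pi fun c => (continuous_apply c.1).comp continuous_subtype_val) x fun y hy => ?_
  have hagree : ∀ p ∈ C, y.1 p = x.1 p := fun p hp => congrFun hy ⟨p, hp⟩
  have hyα : ∀ v, y.1 (α, v) = false := by
    intro v
    by_contra h
    rw [Bool.not_eq_false] at h
    rw [hagree _ (hmem y α v le_rfl h), hα v] at h
    exact Bool.false_ne_true h
  have hhigh : ∀ z : paths e, (∀ v, z.1 (α, v) = false) → ∀ γ v, α ≤ γ → z.1 (γ, v) = false := by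
    intro z hz γ v hγ
    by_contra h
    rw [Bool.not_eq_false] at h
    have := z.2.2.2 γ α v hγ h
    rw [hz] at this
    exact Bool.false_ne_true this
  ext ⟨γ, v⟩
  rcases le_total α γ with h | h
  · rw [hhigh y hyα γ v h, hhigh x hα γ v h]
  · by_cases hp : (γ, v) ∈ C
    · exact hagree _ hp
    · have h1 : y.1 (γ, v) = false := by
        by_contra h1; exact hp (hmem y γ v h (by simpa using h1))
      have h2 : x.1 (γ, v) = false := by
        by_contra h1; exact hp (hmem x γ v h (by simpa using h1))
      rw [h1, h2]

variable (e) in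
/-- The paths without a node in the finite set `node e α n`. -/
def avoid (α : Omega1) (n : ℕ) : Set (paths e) := {x | ∀ v ∈ node e α n, x.1 (α, v) = false}

include he in
theorem isClopen_avoid (α : Omega1) (n : ℕ) : IsClopen (avoid e α n) := by
  have : avoid e α n = ⋂ v ∈ node e α n, {x : paths e | x.1 (α, v) = false} := by
    ext x; simp [avoid]
  rw [this]
  exact (finite_node he α n).isClopen_biInter fun v _ =>
    (isClopen_discrete {false}).preimage ((continuous_apply (α, v)).comp continuous_subtype_val)

include hc in
theorem exists_avoid_subset {α β : Omega1} (h : β < α) :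
    ∃ m, ∀ n ≥ m, avoid e β n ⊆ avoid e α n := by
  obtain ⟨m, hm⟩ := exists_restrict_mem_node hc h
  refine ⟨m, fun n hn x hx v hv => ?_⟩
  by_contra hcon
  rw [Bool.not_eq_false] at hcon
  have := x.2.2.2 α β v h.le hcon
  rw [hx _ (hm n hn v hv)] at this
  exact Bool.false_ne_true this

include he in
theorem exists_forall_mem_avoid (x : paths e) : ∃ α, ∀ β ≥ α, ∀ n, x ∈ avoid e β n := by
  obtain ⟨α, hα⟩ := exists_level_disjoint he x
  refine ⟨α, fun β hβ n v _ => ?_⟩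
  by_contra hcon
  rw [Bool.not_eq_false] at hcon
  have := x.2.2.2 β α v hβ hcon
  rw [hα] at this
  exact Bool.false_ne_true this

include hc in
-- The witness is the path of all restrictions of `e δ`, with `δ` the largest element of `F`: it
-- ends below level `α`, and at each `β ∈ F` it meets `node e β n` for large `n`.
theorem exists_mem_avoid_diff (α : Omega1) {F : Set Omega1} (hF : F.Finite) (hα : ∀ β ∈ F, β < α) :
    ∃ x m, ∀ n ≥ m, x ∈ avoid e α n ∧ ∀ β ∈ F, x ∉ avoid e β n := by
  classical
  have hself : ∀ β, restrict β (e β) ∈ node e β 0 := fun β =>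
    ⟨fun ξ hξ => by simp [restrict, not_lt.2 hξ], fun ξ hξ hne => by simp [restrict, hξ] at hne⟩
  have hres : ∀ β δ, β ≤ δ → ∃ m, ∀ n ≥ m, restrict β (e δ) ∈ node e β n := by
    intro β δ h
    rcases h.eq_or_lt with rfl | h
    · exact ⟨0, fun n hn => node_mono hn (hself β)⟩
    · obtain ⟨m, hm⟩ := exists_restrict_mem_node hc h
      refine ⟨m, fun n hn => ?_⟩
      rw [← restrict_restrict h.le]
      exact hm n hn _ (node_mono (Nat.zero_le _) (hself δ))
  rcases F.eq_empty_or_nonempty with rfl | hne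
  · exact ⟨⟨fun _ => false, by simp [paths]⟩, 0, fun n _ => ⟨fun v _ => rfl, by simp⟩⟩
  obtain ⟨δ, hδ, hmax⟩ := hF.exists_maximal hne
  have hmax : ∀ β ∈ F, β ≤ δ := fun β hβ => (le_total β δ).elim id (hmax hβ)
  choose! m hm using fun β => hres β δ
  let x : paths e := ⟨fun p => decide (p.1 ≤ δ ∧ p.2 = restrict p.1 (e δ)), by
    refine ⟨?_, ?_, ?_⟩
    · rintro ⟨γ, v⟩ h
      obtain ⟨h1, h2⟩ := of_decide_eq_true h
      simp only at h1 h2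
      subst h2
      exact ⟨m γ, hm γ h1 _ le_rfl⟩
    · intro γ v w h1 h2
      exact (of_decide_eq_true h1).2.trans (of_decide_eq_true h2).2.symm
    · intro γ β v hβ h1
      obtain ⟨h2, h3⟩ := of_decide_eq_true h1
      refine decide_eq_true ⟨hβ.trans h2, ?_⟩
      simp only at h3 ⊢
      rw [h3, restrict_restrict hβ]⟩
  obtain ⟨M, hM⟩ := (hF.image m).bddAbove
  refine ⟨x, M, fun n hn => ⟨fun v _ => decide_eq_false fun h => ?_, fun β hβ h => ?_⟩⟩
  · exact absurd h.1 (not_le.2 (hα δ hδ))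
  · have h1 := h _ (hm β (hmax β hβ) n ((hM ⟨β, hβ, rfl⟩).trans hn))
    have h2 : x.1 (β, restrict β (e δ)) = true := decide_eq_true ⟨hmax β hβ, rfl⟩
    rw [h1] at h2
    exact Bool.false_ne_true h2

end AronszajnPath

/-! ### Adding `ω₁` points to `ℕ × K` along a tower of clopen sets -/

/-- A tower, of length `ω₁`, of sequences of clopen subsets of `K`: it increases modulo finite sets
of indices, and it absorbs every point of `K`. -/
structure ClopenTower (K : Type) [TopologicalSpace K] where
  /-- The sequences of clopen sets. -/
  V : Omega1 → ℕ → Set K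
  isClopen : ∀ α n, IsClopen (V α n)
  mono : ∀ α, ∀ β < α, ∃ m, ∀ n ≥ m, V β n ⊆ V α n
  absorb : ∀ k, ∃ α, ∀ β ≥ α, ∀ n, k ∈ V β n
  strict : ∀ α (F : Set Omega1), F.Finite → (∀ β ∈ F, β < α) →
    ∃ k m, ∀ n ≥ m, k ∈ V α n ∧ ∀ β ∈ F, k ∉ V β n

namespace ClopenTower

variable {K : Type} [TopologicalSpace K]

/-- The space made of countably many copies of `K` and a point for each countable ordinal. -/
inductive Space (T : ClopenTower K) : Type
  | pt (n : ℕ) (k : K) : Space T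
  | ordPt (α : Omega1) : Space T

variable (T : ClopenTower K)

open Space

/-- The basic neighbourhoods of the point `ordPt α`. -/
def nbhd (α : Omega1) (F : Set Omega1) (m : ℕ) : Set T.Space :=
  {x | match x with
    | pt n k => m ≤ n ∧ k ∈ T.V α n ∧ ∀ β ∈ F, k ∉ T.V β n
    | ordPt γ => γ ≤ α ∧ ∀ β ∈ F, β < γ}

variable {T}

@[simp] theorem pt_mem_nbhd {α : Omega1} {F : Set Omega1} {m n : ℕ} {k : K} :
    (pt n k : T.Space) ∈ T.nbhd α F m ↔ m ≤ n ∧ k ∈ T.V α n ∧ ∀ β ∈ F, k ∉ T.V β n := Iff.rfl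

@[simp] theorem ordPt_mem_nbhd {α γ : Omega1} {F : Set Omega1} {m : ℕ} :
    (ordPt γ : T.Space) ∈ T.nbhd α F m ↔ γ ≤ α ∧ ∀ β ∈ F, β < γ := Iff.rfl

theorem nbhd_anti {α : Omega1} {F G : Set Omega1} {m n : ℕ} (hFG : F ⊆ G) (hmn : m ≤ n) :
    T.nbhd α G n ⊆ T.nbhd α F m := by
  rintro (⟨i, k⟩ | γ) h
  · exact ⟨hmn.trans h.1, h.2.1, fun β hβ => h.2.2 β (hFG hβ)⟩
  · exact ⟨h.1, fun β hβ => h.2 β (hFG hβ)⟩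

instance : TopologicalSpace T.Space where
  IsOpen U := (∀ n, IsOpen {k | pt n k ∈ U}) ∧
    ∀ α, ordPt α ∈ U → ∃ F : Set Omega1, F.Finite ∧ (∀ β ∈ F, β < α) ∧ ∃ m, T.nbhd α F m ⊆ U
  isOpen_univ := ⟨fun _ => isOpen_univ, fun _ _ =>
    ⟨∅, finite_empty, fun _ h => h.elim, 0, subset_univ _⟩⟩
  isOpen_inter U V hU hV := by
    refine ⟨fun n => (hU.1 n).inter (hV.1 n), fun α hα => ?_⟩
    obtain ⟨F, hF, hFα, m, hm⟩ := hU.2 α hα.1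
    obtain ⟨G, hG, hGα, n, hn⟩ := hV.2 α hα.2
    refine ⟨F ∪ G, hF.union hG, fun β hβ => hβ.elim (hFα β) (hGα β), max m n, ?_⟩
    exact subset_inter ((nbhd_anti subset_union_left (le_max_left _ _)).trans hm)
      ((nbhd_anti subset_union_right (le_max_right _ _)).trans hn)
  isOpen_sUnion 𝒰 h := by
    refine ⟨fun n => ?_, fun α hα => ?_⟩
    · have : {k | (pt n k : T.Space) ∈ ⋃₀ 𝒰} = ⋃ U ∈ 𝒰, {k | pt n k ∈ U} := by
        ext k; simp
      rw [this]
      exact isOpen_biUnion fun U hU => (h U hU).1 n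
    · obtain ⟨U, hU, hαU⟩ := hα
      obtain ⟨F, hF, hFα, m, hm⟩ := (h U hU).2 α hαU
      exact ⟨F, hF, hFα, m, hm.trans (subset_sUnion_of_mem hU)⟩

theorem isOpen_iff {U : Set T.Space} : IsOpen U ↔ (∀ n, IsOpen {k | pt n k ∈ U}) ∧
    ∀ α, ordPt α ∈ U → ∃ F : Set Omega1, F.Finite ∧ (∀ β ∈ F, β < α) ∧ ∃ m, T.nbhd α F m ⊆ U :=
  Iff.rfl

theorem isOpenEmbedding_pt (n : ℕ) : IsOpenEmbedding (pt n : K → T.Space) := by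
  refine .of_continuous_injective_isOpenMap ?_ (fun k l h => by injection h) ?_
  · exact continuous_def.2 fun U hU => (isOpen_iff.1 hU).1 n
  · intro U hU
    refine isOpen_iff.2 ⟨fun m => ?_, fun α hα => ?_⟩
    · rcases eq_or_ne n m with rfl | h
      · convert hU using 1
        ext k
        simp
      · convert isOpen_empty (X := K)
        ext k
        simp [h]
    · obtain ⟨k, -, h⟩ := hα
      cases h

/-- The points of the first `m` copies of `K`. -/
def low (T : ClopenTower K) (m : ℕ) : Set T.Space := ⋃ n ∈ Iio m, range (pt n)

@[simp] theorem pt_mem_low {m n : ℕ} {k : K} : (pt n k : T.Space) ∈ T.low m ↔ n < m := by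
  simp [low]

@[simp] theorem ordPt_not_mem_low {m : ℕ} {α : Omega1} : (ordPt α : T.Space) ∉ T.low m := by
  simp [low]

theorem isClopen_low (m : ℕ) : IsClopen (T.low m) := by
  refine ⟨isOpen_compl_iff.1 (isOpen_iff.2 ⟨fun n => ?_, fun α _ => ?_⟩),
    isOpen_biUnion fun n _ => (isOpenEmbedding_pt n).isOpen_range⟩
  · simp only [mem_compl_iff, pt_mem_low]
    exact isOpen_const
  · refine ⟨∅, finite_empty, fun _ h => h.elim, m, ?_⟩
    rintro (⟨i, k⟩ | γ) h
    · simpa using h.1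
    · simp

theorem isCompact_low [CompactSpace K] (m : ℕ) : IsCompact (T.low m) :=
  (finite_Iio m).isCompact_biUnion fun n _ => isCompact_range (isOpenEmbedding_pt n).continuous

/-- For closedness, a point above `α` may exclude the index `α`. For openness at `γ < α`, `mono`
gives `V γ n ⊆ V α n` for large `n`. -/
theorem isClopen_hat (α : Omega1) : IsClopen (T.nbhd α ∅ 0) := by
  refine ⟨isOpen_compl_iff.1 (isOpen_iff.2 ⟨fun n => ?_, fun γ hγ => ?_⟩),
    isOpen_iff.2 ⟨fun n => ?_, fun γ hγ => ?_⟩⟩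
  · convert (T.isClopen α n).compl.isOpen using 1
    ext k
    simp
  · have hαγ : α < γ := by simpa using hγ
    refine ⟨{α}, finite_singleton α, by simpa using hαγ, 0, ?_⟩
    rintro (⟨i, k⟩ | δ) h
    · simpa using h.2.2
    · simpa using h.2
  · simpa using (T.isClopen α n).isOpen
  · have hγα : γ ≤ α := by simpa using hγ
    rcases hγα.eq_or_lt with rfl | hlt
    · exact ⟨∅, finite_empty, fun _ h => h.elim, 0, Subset.rfl⟩
    · obtain ⟨m, hm⟩ := T.mono α γ hlt
      refine ⟨∅, finite_empty, fun _ h => h.elim, m, ?_⟩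
      rintro (⟨i, k⟩ | δ) h
      · simpa using hm i h.1 h.2.1
      · simpa using h.1.trans hγα

theorem nbhd_eq (α : Omega1) (F : Set Omega1) (m : ℕ) :
    T.nbhd α F m = T.nbhd α ∅ 0 \ (T.low m ∪ ⋃ β ∈ F, T.nbhd β ∅ 0) := by
  ext (⟨i, k⟩ | γ)
  · simp only [pt_mem_nbhd, Set.mem_sdiff, mem_union, pt_mem_low, mem_iUnion, mem_empty_iff_false]
    grind
  · simp only [ordPt_mem_nbhd, Set.mem_sdiff, mem_union, ordPt_not_mem_low, mem_iUnion,
      mem_empty_iff_false]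
    grind

theorem isClopen_nbhd (α : Omega1) {F : Set Omega1} (hF : F.Finite) (m : ℕ) :
    IsClopen (T.nbhd α F m) := by
  rw [nbhd_eq]
  exact (isClopen_hat α).diff
    ((isClopen_low m).union (hF.isClopen_biUnion fun β _ => isClopen_hat β))

theorem ordPt_mem_nbhd_self {α : Omega1} {F : Set Omega1} (hF : ∀ β ∈ F, β < α) (m : ℕ) :
    (ordPt α : T.Space) ∈ T.nbhd α F m := ⟨le_rfl, hF⟩

theorem mem_nhds_ordPt {α : Omega1} {U : Set T.Space} : U ∈ 𝓝 (ordPt α) ↔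
    ∃ F : Set Omega1, F.Finite ∧ (∀ β ∈ F, β < α) ∧ ∃ m, T.nbhd α F m ⊆ U := by
  constructor
  · intro h
    obtain ⟨V, hVU, hV, hα⟩ := mem_nhds_iff.1 h
    obtain ⟨F, hF, hFα, m, hm⟩ := (isOpen_iff.1 hV).2 α hα
    exact ⟨F, hF, hFα, m, hm.trans hVU⟩
  · rintro ⟨F, hF, hFα, m, hm⟩
    exact mem_of_superset ((isClopen_nbhd α hF m).isOpen.mem_nhds (ordPt_mem_nbhd_self hFα m)) hm

instance [FirstCountableTopology K] : FirstCountableTopology T.Space := by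
  refine ⟨?_⟩
  rintro (⟨n, k⟩ | α)
  · rw [← (isOpenEmbedding_pt n).map_nhds_eq]
    infer_instance
  · have hb : (𝓝 (ordPt α : T.Space)).HasBasis
        (fun p : Set Omega1 × ℕ => p ∈ {F | F.Finite ∧ F ⊆ Iio α} ×ˢ (univ : Set ℕ))
        fun p => T.nbhd α p.1 p.2 := by
      refine ⟨fun U => ?_⟩
      rw [mem_nhds_ordPt]
      constructor
      · rintro ⟨F, hF, hFα, m, hm⟩
        exact ⟨(F, m), ⟨⟨hF, hFα⟩, trivial⟩, hm⟩
      · rintro ⟨⟨F, m⟩, ⟨⟨hF, hFα⟩, -⟩, hm⟩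
        exact ⟨F, hF, hFα, m, hm⟩
    exact HasCountableBasis.isCountablyGenerated
      ⟨hb, (countable_ofPred_finite_subset (Omega1.countable_Iio α)).prod countable_univ⟩

instance [T2Space K] : T2Space T.Space := by
  refine ⟨?_⟩
  have hlow : ∀ (n : ℕ) (k : K) (α : Omega1), ∃ u v : Set T.Space, IsOpen u ∧ IsOpen v ∧
      pt n k ∈ u ∧ ordPt α ∈ v ∧ Disjoint u v := fun n k α =>
    ⟨T.low (n + 1), (T.low (n + 1))ᶜ, (isClopen_low _).isOpen, (isClopen_low _).compl.isOpen,
      by simp, by simp, disjoint_compl_right⟩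
  have hlim : ∀ α β : Omega1, α < β → ∃ u v : Set T.Space, IsOpen u ∧ IsOpen v ∧
      ordPt α ∈ u ∧ ordPt β ∈ v ∧ Disjoint u v := fun α β h =>
    ⟨T.nbhd α ∅ 0, (T.nbhd α ∅ 0)ᶜ, (isClopen_hat _).isOpen, (isClopen_hat _).compl.isOpen,
      by simp, by simpa using h, disjoint_compl_right⟩
  rintro (⟨n, k⟩ | α) (⟨m, l⟩ | β) hne
  · rcases eq_or_ne n m with rfl | h
    · obtain ⟨u, v, hu, hv, hku, hlv, huv⟩ :=
        t2_separation (show k ≠ l by rintro rfl; exact hne rfl)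
      exact ⟨pt n '' u, pt n '' v, (isOpenEmbedding_pt n).isOpenMap u hu,
        (isOpenEmbedding_pt n).isOpenMap v hv, mem_image_of_mem _ hku, mem_image_of_mem _ hlv,
        (disjoint_image_iff (isOpenEmbedding_pt n).injective).2 huv⟩
    · refine ⟨range (pt n), range (pt m), (isOpenEmbedding_pt n).isOpen_range,
        (isOpenEmbedding_pt m).isOpen_range, mem_range_self _, mem_range_self _, ?_⟩
      rw [disjoint_left]
      rintro _ ⟨k, rfl⟩ ⟨l, hl⟩
      injection hl with h1
      exact h h1.symm
  · exact hlow n k β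
  · obtain ⟨u, v, hu, hv, h1, h2, h3⟩ := hlow m l α
    exact ⟨v, u, hv, hu, h2, h1, h3.symm⟩
  · rcases lt_trichotomy α β with h | rfl | h
    · exact hlim α β h
    · exact (hne rfl).elim
    · obtain ⟨u, v, hu, hv, h1, h2, h3⟩ := hlim β α h
      exact ⟨v, u, hv, hu, h2, h1, h3.symm⟩

/-- Induction on `α`: by `nbhd_eq`, what a neighbourhood of `ordPt α` leaves uncovered lies in
finitely many copies of `K` and finitely many such sets of smaller index. -/
theorem isCompact_hat [CompactSpace K] (α : Omega1) : IsCompact (T.nbhd α ∅ 0) := by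
  induction α using WellFoundedLT.induction with
  | ind α ih =>
    refine isCompact_of_isCompact_diff (ordPt α) (fun U hU hα => ?_) (by simp)
    obtain ⟨F, hF, hFα, m, hm⟩ := (isOpen_iff.1 hU).2 α hα
    refine ⟨(T.low m ∪ ⋃ β ∈ F, T.nbhd β ∅ 0) ∩ T.nbhd α ∅ 0,
      ((isCompact_low m).union (hF.isCompact_biUnion fun β hβ => ih β (hFα β hβ))).inter_right
        (isClopen_hat α).isClosed, fun x hx => ⟨?_, hx.1⟩, inter_subset_right⟩
    by_contra h
    refine hx.2 (hm ?_)
    rw [nbhd_eq]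
    exact ⟨hx.1, h⟩

instance [CompactSpace K] [T2Space K] : LocallyCompactSpace T.Space := by
  have : WeaklyLocallyCompactSpace T.Space := by
    refine ⟨?_⟩
    rintro (⟨n, k⟩ | α)
    · exact ⟨_, isCompact_low (n + 1), (isClopen_low _).isOpen.mem_nhds (by simp)⟩
    · exact ⟨_, isCompact_hat α, (isClopen_hat _).isOpen.mem_nhds (by simp)⟩
  infer_instance

theorem exists_frequently_mem (n : ℕ → ℕ) (k : ℕ → K) :
    ∃ α, ∀ i, k i ∈ T.V α (n i) := by
  choose a ha using T.absorb
  obtain ⟨α, hα⟩ := Omega1.exists_gt_of_countable (countable_range fun i => a (k i))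
  exact ⟨α, fun i => ha _ α (hα _ ⟨i, rfl⟩).le _⟩

/-- A sequence which leaves all copies of `K` clusters at some `ordPt α`, and it does so outside of
any set `V γ` that misses it. -/
theorem exists_ordPt_frequently {n : ℕ → ℕ} (hn : Tendsto n atTop atTop) (k : ℕ → K) :
    ∃ α, (∀ N ∈ 𝓝 (ordPt α : T.Space), ∃ᶠ i in atTop, pt (n i) (k i) ∈ N) ∧
      ∀ γ, (∀ i, k i ∉ T.V γ (n i)) → γ < α := by
  -- Smaller indices catch only finitely many terms, so excluding finitely many of them keeps the
  -- sequence frequently in the neighbourhood.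
  obtain ⟨α, hα, hmin⟩ := exists_minimal_of_wellFoundedLT
    (fun α => ∃ᶠ i in atTop, k i ∈ T.V α (n i)) (by
      obtain ⟨α, hα⟩ := T.exists_frequently_mem n k
      exact ⟨α, Eventually.frequently (Eventually.of_forall hα)⟩)
  refine ⟨α, fun N hN => ?_, fun γ hγ => ?_⟩
  · obtain ⟨F, hF, hFα, m, hm⟩ := mem_nhds_ordPt.1 hN
    have h1 : ∀ᶠ i in atTop, ∀ β ∈ F, k i ∉ T.V β (n i) := by
      rw [eventually_all_finite hF]
      intro β hβ
      by_contra hcon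
      have := hmin (y := β) (fun h => hcon (h.mono fun i hi => hi)) (hFα β hβ).le
      exact absurd (hFα β hβ) (not_lt.2 this)
    exact ((hα.and_eventually h1).and_eventually (hn.eventually_ge_atTop m)).mono
      fun i hi => hm ⟨hi.2, hi.1.1, hi.1.2⟩
  · by_contra! h
    rcases h.eq_or_lt with rfl | h
    · obtain ⟨i, hi⟩ := hα.exists
      exact hγ i hi
    · obtain ⟨m, hm⟩ := T.mono γ α h
      obtain ⟨i, hi, him⟩ := (hα.and_eventually (hn.eventually_ge_atTop m)).exists
      exact hγ i (hm _ him hi)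

/-- Outside `nbhd α ∅ 0` only finitely many copies of `K` matter: otherwise a sequence in `H` that
misses the sets `V α n` would cluster at an ordinal point of `H` above `α`. -/
theorem isCompact_of_bounded [CompactSpace K] {H : Set T.Space} (hH : IsClosed H) (α : Omega1)
    (hα : ∀ γ, ordPt γ ∈ H → γ ≤ α) : IsCompact H := by
  obtain ⟨m, hm⟩ : ∃ m, H \ T.nbhd α ∅ 0 ⊆ T.low m := by
    by_contra! hcon
    have : ∀ m, ∃ n k, m ≤ n ∧ pt n k ∈ H ∧ k ∉ T.V α n := by
      intro m
      obtain ⟨x, hx, hxm⟩ := not_subset.1 (hcon m)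
      rcases x with ⟨n, k⟩ | γ
      · exact ⟨n, k, by simpa using hxm, hx.1, by simpa using hx.2⟩
      · exact absurd (hα γ hx.1) (by simpa using hx.2)
    choose n k hn hk hkα using this
    obtain ⟨γ, hγ, hlt⟩ := T.exists_ordPt_frequently
      (tendsto_atTop_mono hn tendsto_id) k
    have hγH : ordPt γ ∈ H := by
      rw [← hH.closure_eq, mem_closure_iff_nhds]
      intro N hN
      obtain ⟨i, hi⟩ := (hγ N hN).exists
      exact ⟨_, hi, hk i⟩
    exact absurd (hlt α hkα) (not_lt.2 (hα γ hγH))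
  refine ((isCompact_hat α).union (isCompact_low m)).of_isClosed_subset hH fun x hx => ?_
  by_cases h : x ∈ T.nbhd α ∅ 0
  · exact Or.inl h
  · exact Or.inr (hm ⟨hx, h⟩)

theorem ordPt_mem_of_isLUB {H : Set T.Space} (hH : IsClosed H) {a : ℕ → Omega1} {α : Omega1}
    (ha : IsLUB (range a) α) (hlt : ∀ n, a n < α) (haH : ∀ n, ∃ β, a n ≤ β ∧ β < α ∧ ordPt β ∈ H) :
    ordPt α ∈ H := by
  rw [← hH.closure_eq, mem_closure_iff_nhds]
  intro N hN
  obtain ⟨F, hF, hFα, m, hm⟩ := mem_nhds_ordPt.1 hN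
  obtain ⟨δ, hδα, hδ⟩ : ∃ δ < α, ∀ β ∈ F, β ≤ δ := by
    rcases F.eq_empty_or_nonempty with rfl | hne
    · exact ⟨a 0, hlt 0, by simp⟩
    · obtain ⟨δ, hδ, hmax⟩ := hF.exists_maximal hne
      exact ⟨δ, hFα δ hδ, fun β hβ => (le_total β δ).elim id (hmax hβ)⟩
  obtain ⟨_, ⟨n, rfl⟩, hn⟩ := (lt_isLUB_iff ha).1 hδα
  obtain ⟨β, h1, h2, h3⟩ := haH n
  exact ⟨ordPt β, hm ⟨h2.le, fun γ hγ => ((hδ γ hγ).trans_lt hn).trans_le h1⟩, h3⟩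

/-- As for closed unbounded subsets of ω₁: ordinals from the two sets interleave, and their supremum
lies in both. -/
theorem inter_nonempty_of_unbounded {H L : Set T.Space} (hH : IsClosed H) (hL : IsClosed L)
    (hHu : ∀ α, ∃ γ, α < γ ∧ ordPt γ ∈ H) (hLu : ∀ α, ∃ γ, α < γ ∧ ordPt γ ∈ L) :
    (H ∩ L).Nonempty := by
  choose f hf hfH using hHu
  choose g hg hgL using hLu
  have : Nonempty Omega1 := (inferInstance : Infinite Omega1).nonempty
  let a : ℕ → Omega1 := fun n => (fun x => g (f x))^[n] (Classical.arbitrary _)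
  have hsucc : ∀ n, a (n + 1) = g (f (a n)) := fun n => Function.iterate_succ_apply' _ _ _
  obtain ⟨α, hα⟩ := Omega1.exists_isLUB_of_countable (countable_range a)
  have hle : ∀ n, a n ≤ α := fun n => hα.1 ⟨n, rfl⟩
  have hg' : ∀ n, g (f (a n)) < α := fun n => by
    refine lt_of_lt_of_le ?_ (hle (n + 2))
    rw [hsucc (n + 1), hsucc n]
    exact (hf _).trans (hg _)
  have hf' : ∀ n, f (a n) < α := fun n => (hg _).trans (hg' n)
  have hlt : ∀ n, a n < α := fun n => (hf _).trans (hf' n)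
  exact ⟨ordPt α, ordPt_mem_of_isLUB hH hα hlt fun n => ⟨_, (hf _).le, hf' n, hfH _⟩,
    ordPt_mem_of_isLUB hL hα hlt fun n => ⟨_, ((hf _).trans (hg _)).le, hg' n, hgL _⟩⟩

instance [CompactSpace K] [T2Space K] : T4Space T.Space := by
  have : NormalSpace T.Space := by
    refine normalSpace_of_isCompact_or fun H L hH hL hHL => ?_
    by_contra! hcon
    have hunb : ∀ S : Set T.Space, IsClosed S → ¬ IsCompact S → ∀ α, ∃ γ, α < γ ∧ ordPt γ ∈ S := by
      intro S hS hSc α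
      by_contra! h
      exact hSc (isCompact_of_bounded hS α fun γ hγ => not_lt.1 fun hlt => h γ hlt hγ)
    exact (inter_nonempty_of_unbounded hH hL (hunb H hH hcon.1) (hunb L hL hcon.2)).ne_empty
      hHL.inter_eq
  infer_instance

/-- The field `strict` exists for this: it puts points of copies of `K` into every basic
neighbourhood of an ordinal point. -/
theorem dense_iUnion_low : Dense (⋃ m, T.low m) := by
  rintro (⟨n, k⟩ | α)
  · exact subset_closure (mem_iUnion.2 ⟨n + 1, by simp⟩)
  · rw [mem_closure_iff_nhds]
    intro N hN
    obtain ⟨F, hF, hFα, m, hm⟩ := mem_nhds_ordPt.1 hN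
    obtain ⟨k, l, hl⟩ := T.strict α F hF hFα
    refine ⟨pt (max l m) k, hm ⟨le_max_right _ _, hl _ (le_max_left _ _)⟩,
      mem_iUnion.2 ⟨max l m + 1, by simp⟩⟩

theorem exists_countable_subcover_low [CompactSpace K] {𝒰 : Set (Set T.Space)}
    (ho : ∀ U ∈ 𝒰, IsOpen U) (hc : ⋃₀ 𝒰 = univ) :
    ∃ 𝒱 ⊆ 𝒰, 𝒱.Countable ∧ ⋃ m, T.low m ⊆ ⋃₀ 𝒱 := by
  have : ∀ m, ∃ 𝒱 ⊆ 𝒰, 𝒱.Finite ∧ T.low m ⊆ ⋃₀ 𝒱 := by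
    intro m
    obtain ⟨𝒱, h1, h2, h3⟩ := (isCompact_low (T := T) m).elim_finite_subcover_image (b := 𝒰)
      (c := id) ho (by simp only [id, ← sUnion_eq_biUnion, hc, subset_univ])
    exact ⟨𝒱, h1, h2, by simpa [sUnion_eq_biUnion] using h3⟩
  choose 𝒱 h1 h2 h3 using this
  refine ⟨⋃ m, 𝒱 m, iUnion_subset h1, countable_iUnion fun m => (h2 m).countable,
    iUnion_subset fun m => (h3 m).trans (sUnion_subset_sUnion (subset_iUnion _ m))⟩

instance : Nonempty T.Space :=
  have : Nonempty Omega1 := (inferInstance : Infinite Omega1).nonempty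
  ⟨ordPt (Classical.arbitrary _)⟩

theorem linearlyHClosed [CompactSpace K] : LinearlyHClosed T.Space := by
  refine linearlyHClosed_of_weaklyLindelof_of_feeblyCompact (fun 𝒰 ho hc => ?_) fun V hV hne => ?_
  · obtain ⟨𝒱, h1, h2, h3⟩ := exists_countable_subcover_low ho hc
    exact ⟨𝒱, h1, h2, dense_iUnion_low.mono h3⟩
  · have : ∀ i, ∃ n k, pt n k ∈ V i := by
      intro i
      obtain ⟨x, hx, hxV⟩ := dense_iUnion_low.inter_open_nonempty _ (hV i) (hne i)
      rcases x with ⟨n, k⟩ | γ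
      · exact ⟨n, k, hx⟩
      · simp at hxV
    choose n k hk using this
    suffices h : ∃ x : T.Space, ∀ N ∈ 𝓝 x, ∃ᶠ i in atTop, pt (n i) (k i) ∈ N by
      obtain ⟨x, hx⟩ := h
      exact ⟨x, fun N hN => (hx N hN).mono fun i hi => ⟨_, hk i, hi⟩⟩
    -- Either the sequence leaves all copies of `K`, or infinitely many terms lie in one compact set
    -- `T.low m`.
    by_cases htop : Tendsto n atTop atTop
    · obtain ⟨α, hα, -⟩ := T.exists_ordPt_frequently htop k
      exact ⟨ordPt α, hα⟩
    · obtain ⟨m, hm⟩ : ∃ m, ∃ᶠ i in atTop, n i < m := by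
        simpa only [tendsto_atTop, not_forall, not_eventually, not_le] using htop
      obtain ⟨x, -, hx⟩ := (isCompact_low (T := T) m).exists_mapClusterPt_of_frequently
        (f := fun i => pt (n i) (k i)) (l := atTop) (hm.mono fun i hi => by simpa using hi)
      exact ⟨x, fun N hN => mapClusterPt_iff_frequently.1 hx N hN⟩

theorem isOpen_hat_union_low (α : Omega1) : IsOpen (T.nbhd α ∅ 0 ∪ ⋃ m, T.low m) :=
  (isClopen_hat α).isOpen.union (isOpen_iUnion fun m => (isClopen_low m).isOpen)

theorem exists_not_mem_of_countable {s : Set Omega1} (hs : s.Countable) :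
    ∃ x : T.Space, ∀ α ∈ s, x ∉ T.nbhd α ∅ 0 ∪ ⋃ m, T.low m := by
  obtain ⟨γ, hγ⟩ := Omega1.exists_gt_of_countable hs
  exact ⟨ordPt γ, fun α hα => by simpa using hγ α hα⟩

theorem sUnion_range_hat :
    ⋃₀ range (fun α => T.nbhd α ∅ 0 ∪ ⋃ m, T.low m) = univ := by
  refine eq_univ_of_forall ?_
  have : Nonempty Omega1 := (inferInstance : Infinite Omega1).nonempty
  rintro (⟨n, k⟩ | α)
  · exact ⟨_, ⟨Classical.arbitrary _, rfl⟩, Or.inr (mem_iUnion.2 ⟨n + 1, by simp⟩)⟩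
  · exact ⟨_, ⟨α, rfl⟩, Or.inl (by simp)⟩

theorem not_countable_subcover {𝒱 : Set (Set T.Space)}
    (h𝒱 : 𝒱 ⊆ range (fun α => T.nbhd α ∅ 0 ∪ ⋃ m, T.low m)) (hc : 𝒱.Countable) : ⋃₀ 𝒱 ≠ univ := by
  intro hcov
  have := hc.to_subtype
  choose a ha using fun U : 𝒱 => h𝒱 U.2
  obtain ⟨x, hx⟩ := exists_not_mem_of_countable (T := T) (countable_range a)
  obtain ⟨U, hU, hxU⟩ : x ∈ ⋃₀ 𝒱 := hcov ▸ mem_univ x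
  refine hx _ ⟨⟨U, hU⟩, rfl⟩ ?_
  have h := ha ⟨U, hU⟩
  simp only at h
  rwa [h]

theorem not_compactSpace : ¬ CompactSpace T.Space := by
  intro h
  obtain ⟨𝒱, h1, h2, h3⟩ := (isCompact_univ (X := T.Space)).elim_finite_subcover_image
    (b := range (fun α => T.nbhd α ∅ 0 ∪ ⋃ m, T.low m)) (c := id)
    (by rintro _ ⟨α, rfl⟩; exact isOpen_hat_union_low α)
    (by simp only [id, ← sUnion_eq_biUnion, sUnion_range_hat, Subset.rfl])
  exact not_countable_subcover h1 h2.countable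
    (univ_subset_iff.1 (by simpa [sUnion_eq_biUnion] using h3))

/-- Countably many members cover the σ-compact part, and one more per countable ordinal covers the
rest. The lower bound comes from the bounded indices of a countable subfamily of the cover in
`sUnion_range_hat`. -/
theorem lindelofNumber_eq [CompactSpace K] : lindelofNumber T.Space = ℵ₁ := by
  refine le_antisymm (csInf_le' fun 𝒰 ho hc => ?_) (le_csInf ⟨#(Set T.Space), ?_⟩ fun κ hκ => ?_)
  · obtain ⟨𝒱, h1, h2, h3⟩ := exists_countable_subcover_low ho hc
    have : ∀ α : Omega1, ∃ U ∈ 𝒰, ordPt α ∈ U := fun α => by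
      simpa using (hc ▸ mem_univ _ : (ordPt α : T.Space) ∈ ⋃₀ 𝒰)
    choose U hU hαU using this
    refine ⟨𝒱 ∪ range U, union_subset h1 (range_subset_iff.2 hU), eq_univ_of_forall ?_, ?_⟩
    · rintro (⟨n, k⟩ | α)
      · exact sUnion_subset_sUnion subset_union_left (h3 (mem_iUnion.2 ⟨n + 1, by simp⟩))
      · exact ⟨U α, Or.inr ⟨α, rfl⟩, hαU α⟩
    · refine (Cardinal.mk_union_le _ _).trans
        (Cardinal.add_le_of_le (Cardinal.aleph0_le_aleph 1) ?_ ?_)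
      · exact (Cardinal.le_aleph0_iff_set_countable.2 h2).trans (Cardinal.aleph0_le_aleph 1)
      · exact Cardinal.mk_range_le.trans Omega1.mk_eq.le
  · exact fun 𝒰 _ hc => ⟨𝒰, Subset.rfl, hc, Cardinal.mk_set_le _⟩
  · by_contra! hlt
    obtain ⟨𝒱, h1, h2, h3⟩ := hκ _ (by rintro _ ⟨α, rfl⟩; exact isOpen_hat_union_low α)
      sUnion_range_hat
    refine not_countable_subcover h1 ?_ h2
    rw [← Cardinal.le_aleph0_iff_set_countable, ← Cardinal.lt_aleph_one_iff]
    exact h3.trans_lt hlt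

end ClopenTower

theorem exists_tower_space : ∃ (X : Type) (_ : TopologicalSpace X),
    LinearlyHClosed X ∧ ¬ CompactSpace X ∧ FirstCountableTopology X ∧ LocallyCompactSpace X ∧
      T4Space X ∧ lindelofNumber X = ℵ₁ := by
  obtain ⟨e, he, hc⟩ := Omega1.exists_coherent
  have := AronszajnPath.firstCountable_paths he
  let T : ClopenTower (AronszajnPath.paths e) :=
    { V := AronszajnPath.avoid e
      isClopen := AronszajnPath.isClopen_avoid he
      mono := fun _ _ h => AronszajnPath.exists_avoid_subset hc h
      absorb := AronszajnPath.exists_forall_mem_avoid he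
      strict := fun α _ hF hα => AronszajnPath.exists_mem_avoid_diff hc α hF hα }
  exact ⟨T.Space, inferInstance, T.linearlyHClosed, T.not_compactSpace, inferInstance,
    inferInstance, inferInstance, T.lindelofNumber_eq⟩

/-! ### Ostaszewski's construction -/

/-- Countably many infinite sets of natural numbers can be split simultaneously into countably many
infinite pieces. -/
theorem exists_coloring {ι : Type*} [Countable ι] (H : ι → Set ℕ) :
    ∃ c : ℕ → ℕ, ∀ i, (H i).Infinite → ∀ n, {k ∈ H i | c k = n}.Infinite := by
  cases isEmpty_or_nonempty {i // (H i).Infinite} with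
  | inl h => exact ⟨id, fun i hi => (h.false ⟨i, hi⟩).elim⟩
  | inr h =>
    -- Each request is a set, a colour and a counter that repeats the request infinitely often. It
    -- is served by a new, larger number of that set; unused numbers get the harmless colour 0.
    obtain ⟨s, hs⟩ := exists_surjective_nat ({i // (H i).Infinite} × ℕ × ℕ)
    have hpick : ∀ r b, ∃ k, k ∈ H (s r).1 ∧ b < k := fun r b => (s r).1.2.exists_gt b
    choose p hp hb using hpick
    let k : ℕ → ℕ := fun r => Nat.rec (p 0 0) (fun r b => p (r + 1) b) r
    have hk : StrictMono k := strictMono_nat_of_lt_succ fun r => hb (r + 1) (k r)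
    have hkH : ∀ r, k r ∈ H (s r).1 := by
      rintro (_ | r)
      · exact hp 0 0
      · exact hp (r + 1) (k r)
    refine ⟨Function.extend k (fun r => (s r).2.1) 0, fun i hi n => ?_⟩
    choose q hq using hs
    refine (infinite_range_of_injective (f := fun j => k (q (⟨i, hi⟩, n, j))) ?_).mono ?_
    · intro a b hab
      have h1 := congrArg s (hk.injective hab)
      rw [hq, hq] at h1
      exact congrArg (fun t => t.2.2) h1
    · rintro _ ⟨j, rfl⟩
      have h1 := hkH (q (⟨i, hi⟩, n, j))
      rw [hq] at h1
      refine ⟨h1, ?_⟩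
      rw [hk.injective.extend_apply, hq]

/-- The data of Ostaszewski's construction: at level `α`, the points of lower level are ranked, and
the ranks are coloured; the neighbourhoods of `(α, n)` consist of the points of colour `n` and of
large rank. -/
structure OstaszewskiData (G : Omega1 → ℕ → Set (Omega1 × ℕ)) where
  /-- Enumerations of the lower levels. -/
  f : Omega1 → Omega1 × ℕ → ℕ
  /-- The rank at level `α`. -/
  rank : Omega1 → Omega1 × ℕ → ℕ
  /-- The colouring of the ranks at level `α`. -/
  col : Omega1 → ℕ → ℕ
  injOn : ∀ α, InjOn (f α) {y | y.1 < α}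
  -- The last disjunction is membership of `z` in the neighbourhood `nbhd y 0` defined below, so the
  -- rank is the least index of such a neighbourhood containing `z`.
  rank_eq : ∀ α z, rank α z = sInf {k | ∃ y : Omega1 × ℕ, y.1 < α ∧ f α y = k ∧
    (z = y ∨ z.1 < y.1 ∧ col y.1 (rank y.1 z) = y.2)}
  col_spec : ∀ α, ∀ γ ≤ α, ∀ i, (rank α '' (G γ i ∩ {z | z.1 < α})).Infinite →
    ∀ n, {k ∈ rank α '' (G γ i ∩ {z | z.1 < α}) | col α k = n}.Infinite

/-- The recursive definition of the ranks. -/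
noncomputable def ostaszewskiRank (f : Omega1 → Omega1 × ℕ → ℕ)
    (C : Omega1 → (Omega1 × ℕ → ℕ) → ℕ → ℕ) (α : Omega1) (z : Omega1 × ℕ) : ℕ :=
  sInf {k | ∃ y : Omega1 × ℕ, ∃ _h : y.1 < α, f α y = k ∧
    (z = y ∨ z.1 < y.1 ∧
      C y.1 (fun w => ostaszewskiRank f C y.1 w) (ostaszewskiRank f C y.1 z) = y.2)}
termination_by α

theorem Omega1.countable_lt_level (α : Omega1) : {y : Omega1 × ℕ | y.1 < α}.Countable :=
  ((Omega1.countable_Iio α).prod (countable_univ (α := ℕ))).mono fun _ hy =>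
    mk_mem_prod hy (mem_univ _)

/-- The colouring of a level depends only on its rank function, which depends on lower levels. So
`C` answers every possible rank function in advance, and recursion supplies the actual one. -/
theorem nonempty_ostaszewskiData (G : Omega1 → ℕ → Set (Omega1 × ℕ)) :
    Nonempty (OstaszewskiData G) := by
  choose f hf using fun α => countable_iff_exists_injOn.1 (Omega1.countable_lt_level α)
  have hC : ∀ (α : Omega1) (κ : Omega1 × ℕ → ℕ), ∃ c : ℕ → ℕ, ∀ γ ≤ α, ∀ i,
      (κ '' (G γ i ∩ {z | z.1 < α})).Infinite →
        ∀ n, {k ∈ κ '' (G γ i ∩ {z | z.1 < α}) | c k = n}.Infinite := by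
    intro α κ
    have := (Omega1.countable_Iic α).to_subtype
    obtain ⟨c, hc⟩ := exists_coloring fun p : Iic α × ℕ => κ '' (G p.1 p.2 ∩ {z | z.1 < α})
    exact ⟨c, fun γ hγ i => hc (⟨γ, hγ⟩, i)⟩
  choose C hC using hC
  exact ⟨{
    f := f
    rank := ostaszewskiRank f C
    col := fun α => C α (ostaszewskiRank f C α)
    injOn := hf
    rank_eq := fun α z => by
      rw [ostaszewskiRank]
      simp only [exists_prop]
    col_spec := fun α => hC α _ }⟩

/-! ### Neighbourhoods from ranks and colours, and accumulation at whole levels -/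

namespace OstaszewskiData

variable {G : Omega1 → ℕ → Set (Omega1 × ℕ)} (D : OstaszewskiData G)

/-- The basic neighbourhoods. -/
def nbhd (z : Omega1 × ℕ) (j : ℕ) : Set (Omega1 × ℕ) :=
  {w | w = z ∨ w.1 < z.1 ∧ j ≤ D.rank z.1 w ∧ D.col z.1 (D.rank z.1 w) = z.2}

variable {D}

theorem self_mem_nbhd (z : Omega1 × ℕ) (j : ℕ) : z ∈ D.nbhd z j := Or.inl rfl

theorem nbhd_anti (z : Omega1 × ℕ) {i j : ℕ} (h : i ≤ j) : D.nbhd z j ⊆ D.nbhd z i :=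
  fun _ hw => hw.imp id fun hw => ⟨hw.1, h.trans hw.2.1, hw.2.2⟩

theorem eq_or_lt_of_mem_nbhd {w z : Omega1 × ℕ} {j : ℕ} (h : w ∈ D.nbhd z j) :
    w = z ∨ w.1 < z.1 := h.imp id fun h => h.1

theorem le_of_mem_nbhd {w z : Omega1 × ℕ} {j : ℕ} (h : w ∈ D.nbhd z j) : w.1 ≤ z.1 := by
  rcases eq_or_lt_of_mem_nbhd h with rfl | h
  · exact le_rfl
  · exact h.le

theorem rank_eq' (α : Omega1) (z : Omega1 × ℕ) :
    D.rank α z = sInf {k | ∃ y : Omega1 × ℕ, y.1 < α ∧ D.f α y = k ∧ z ∈ D.nbhd y 0} := by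
  rw [D.rank_eq]
  simp [nbhd]

theorem rank_le {α : Omega1} {w y : Omega1 × ℕ} (hy : y.1 < α) (hw : w ∈ D.nbhd y 0) :
    D.rank α w ≤ D.f α y := by
  rw [rank_eq']
  exact Nat.sInf_le ⟨y, hy, rfl, hw⟩

theorem exists_rank_eq {α : Omega1} {w : Omega1 × ℕ} (hw : w.1 < α) :
    ∃ y : Omega1 × ℕ, y.1 < α ∧ D.f α y = D.rank α w ∧ w ∈ D.nbhd y 0 := by
  rw [rank_eq']
  exact Nat.sInf_mem (s := {k | ∃ y : Omega1 × ℕ, y.1 < α ∧ D.f α y = k ∧ w ∈ D.nbhd y 0})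
    ⟨_, w, hw, rfl, self_mem_nbhd w 0⟩

theorem finite_index_le (D : OstaszewskiData G) (α : Omega1) (k : ℕ) :
    {y : Omega1 × ℕ | y.1 < α ∧ D.f α y ≤ k}.Finite := by
  refine Finite.of_finite_image ((finite_Iic k).subset ?_) ((D.injOn α).mono fun y hy => hy.1)
  rintro _ ⟨y, hy, rfl⟩
  exact hy.2

/-- Finitely many basic neighbourhoods of points of lower level do not cover infinitely many points
of a level which none of them exceeds. -/
theorem not_forall_mem_biUnion {F : Set (Omega1 × ℕ)} (hF : F.Finite) {β : Omega1}
    (hβ : ∀ y ∈ F, y.1 ≤ β) : ¬ ∀ n, (β, n) ∈ ⋃ y ∈ F, D.nbhd y 0 := by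
  intro h
  refine infinite_univ (α := ℕ) ((hF.image Prod.snd).subset fun n _ => ?_)
  obtain ⟨y, hy, hn⟩ := mem_iUnion₂.1 (h n)
  rcases eq_or_lt_of_mem_nbhd hn with rfl | hlt
  · exact ⟨_, hy, rfl⟩
  · exact absurd (hβ y hy) (not_le.2 hlt)

variable [TopologicalSpace (Omega1 × ℕ)]

/-- The topology is the one which the basic neighbourhoods generate. -/
def Compatible (D : OstaszewskiData G) : Prop :=
  ∀ U : Set (Omega1 × ℕ), IsOpen U ↔ ∀ z ∈ U, ∃ j, D.nbhd z j ⊆ U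

variable (hD : D.Compatible)

include hD in
-- Near `z` one stays inside the neighbourhood that realizes the rank and outside the finitely many
-- clopen ones of smaller index.
theorem exists_rank_const {α : Omega1}
    (ih : ∀ y : Omega1 × ℕ, y.1 < α → IsClopen (D.nbhd y 0)) {z : Omega1 × ℕ} (hz : z.1 < α) :
    ∃ i, ∀ w ∈ D.nbhd z i, w.1 < α ∧ D.rank α w = D.rank α z := by
  obtain ⟨y, hy, hfy, hzy⟩ := exists_rank_eq (D := D) hz
  have hfin : {y' : Omega1 × ℕ | y'.1 < α ∧ D.f α y' < D.rank α z}.Finite :=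
    (D.finite_index_le α (D.rank α z)).subset fun y' hy' => ⟨hy'.1, hy'.2.le⟩
  have hU : IsOpen (D.nbhd y 0 ∩ ⋂ y' ∈ {y' : Omega1 × ℕ | y'.1 < α ∧ D.f α y' < D.rank α z},
      (D.nbhd y' 0)ᶜ) :=
    (ih y hy).isOpen.inter (hfin.isOpen_biInter fun y' hy' => (ih y' hy'.1).compl.isOpen)
  obtain ⟨i, hi⟩ := (hD _).1 hU z ⟨hzy, mem_iInter₂.2 fun y' hy' h =>
    absurd (rank_le hy'.1 h) (not_le.2 hy'.2)⟩
  refine ⟨i, fun w hw => ?_⟩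
  have hwα : w.1 < α := (le_of_mem_nbhd hw).trans_lt hz
  refine ⟨hwα, le_antisymm (hfy ▸ rank_le hy (hi hw).1) ?_⟩
  by_contra! hlt
  obtain ⟨y', hy', hfy', hwy'⟩ := exists_rank_eq (D := D) hwα
  exact mem_iInter₂.1 (hi hw).2 y' ⟨hy', hfy' ▸ hlt⟩ hwy'

include hD in
-- Below level `α` the rank is locally constant; within level `α` distinct colours separate points.
-- A point `w` of higher level has neighbourhoods of arbitrarily large rank, while the set in
-- question has rank at most `D.f w.1 (α, n)` there.
theorem isClopen_nbhd (z : Omega1 × ℕ) (j : ℕ) : IsClopen (D.nbhd z j) := by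
  suffices h : ∀ α : Omega1, ∀ n j, IsClopen (D.nbhd (α, n) j) from h z.1 z.2 j
  intro α
  induction α using WellFoundedLT.induction with
  | ind α ih =>
    intro n j
    have hconst := fun w hw => exists_rank_const hD (fun y hy => ih y.1 hy y.2 0) (z := w) hw
    constructor
    · rw [← isOpen_compl_iff, hD]
      intro w hw
      rcases lt_trichotomy w.1 α with h | h | h
      · obtain ⟨i, hi⟩ := hconst w h
        refine ⟨i, fun v hv hv' => hw (Or.inr ⟨h, ?_⟩)⟩
        rcases hv' with rfl | hv'
        · exact absurd (hi _ hv).1 (lt_irrefl _)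
        · simpa only [← (hi v hv).2] using hv'.2
      · refine ⟨0, fun v hv hv' => ?_⟩
        rcases hv with rfl | hv
        · exact hw hv'
        · rcases hv' with rfl | hv'
          · exact absurd hv.1 (by simp [h])
          · refine hw (Or.inl (Prod.ext h ?_))
            rw [← hv.2.2, ← hv'.2.2, h]
      · refine ⟨D.f w.1 (α, n) + 1, fun v hv hv' => ?_⟩
        rcases hv with rfl | hv
        · exact absurd h (not_lt.2 (le_of_mem_nbhd hv'))
        · have := rank_le (α := w.1) h (nbhd_anti _ (Nat.zero_le _) hv')
          exact absurd (hv.2.1.trans this) (by simp)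
    · rw [hD]
      intro w hw
      rcases hw with rfl | hw
      · exact ⟨j, Subset.rfl⟩
      · obtain ⟨i, hi⟩ := hconst w hw.1
        refine ⟨i, fun v hv => Or.inr ⟨(hi v hv).1, ?_⟩⟩
        simpa only [(hi v hv).2] using hw.2

include hD in
theorem mem_nhds_iff_nbhd {z : Omega1 × ℕ} {U : Set (Omega1 × ℕ)} :
    U ∈ 𝓝 z ↔ ∃ j, D.nbhd z j ⊆ U := by
  constructor
  · intro h
    obtain ⟨V, hVU, hV, hz⟩ := mem_nhds_iff.1 h
    obtain ⟨j, hj⟩ := (hD V).1 hV z hz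
    exact ⟨j, hj.trans hVU⟩
  · rintro ⟨j, hj⟩
    exact mem_of_superset ((isClopen_nbhd hD z j).isOpen.mem_nhds (self_mem_nbhd z j)) hj

include hD in
theorem firstCountableTopology : FirstCountableTopology (Omega1 × ℕ) := by
  refine ⟨fun z => ?_⟩
  have hb : (𝓝 z).HasBasis (fun _ : ℕ => True) (D.nbhd z) :=
    ⟨fun U => by simpa using mem_nhds_iff_nbhd hD⟩
  exact HasCountableBasis.isCountablyGenerated ⟨hb, to_countable _⟩

include hD in
theorem t2Space : T2Space (Omega1 × ℕ) := by
  have hlt : ∀ z w : Omega1 × ℕ, z.1 < w.1 ∨ z.1 = w.1 ∧ z ≠ w → w ∉ D.nbhd z 0 := by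
    intro z w h hw
    rcases eq_or_lt_of_mem_nbhd hw with rfl | hw
    · simp at h
    · rcases h with h | h
      · exact lt_asymm h hw
      · exact hw.ne h.1.symm
  refine ⟨fun z w hne => ?_⟩
  rcases lt_trichotomy z.1 w.1 with h | h | h
  · exact ⟨D.nbhd z 0, (D.nbhd z 0)ᶜ, (isClopen_nbhd hD z 0).isOpen,
      (isClopen_nbhd hD z 0).compl.isOpen, self_mem_nbhd z 0, hlt z w (Or.inl h),
      disjoint_compl_right⟩
  · exact ⟨D.nbhd z 0, (D.nbhd z 0)ᶜ, (isClopen_nbhd hD z 0).isOpen,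
      (isClopen_nbhd hD z 0).compl.isOpen, self_mem_nbhd z 0, hlt z w (Or.inr ⟨h, hne⟩),
      disjoint_compl_right⟩
  · exact ⟨(D.nbhd w 0)ᶜ, D.nbhd w 0, (isClopen_nbhd hD w 0).compl.isOpen,
      (isClopen_nbhd hD w 0).isOpen, hlt w z (Or.inl h), self_mem_nbhd w 0,
      disjoint_compl_left⟩

include hD in
-- A neighbourhood of the top point omits only points of bounded rank, which finitely many
-- neighbourhoods of lower points cover.
theorem isCompact_nbhd (z : Omega1 × ℕ) : IsCompact (D.nbhd z 0) := by
  suffices h : ∀ α : Omega1, ∀ n, IsCompact (D.nbhd (α, n) 0) from h z.1 z.2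
  intro α
  induction α using WellFoundedLT.induction with
  | ind α ih =>
    intro n
    refine isCompact_of_isCompact_diff (α, n) (fun U hU hα => ?_) (self_mem_nbhd _ 0)
    obtain ⟨j, hj⟩ := (hD U).1 hU _ hα
    refine ⟨(⋃ y ∈ {y : Omega1 × ℕ | y.1 < α ∧ D.f α y ≤ j}, D.nbhd y 0) ∩ D.nbhd (α, n) 0,
      ((D.finite_index_le α j).isCompact_biUnion fun y hy => ih y.1 hy.1 y.2).inter_right
        (isClopen_nbhd hD _ 0).isClosed, fun w hw => ⟨?_, hw.1⟩, inter_subset_right⟩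
    rcases hw.1 with rfl | h
    · exact (hw.2 hα).elim
    · obtain ⟨y, hy, hfy, hwy⟩ := exists_rank_eq (D := D) h.1
      refine mem_biUnion (x := y) ⟨hy, ?_⟩ hwy
      by_contra! hlt
      exact hw.2 (hj (Or.inr ⟨h.1, (hfy ▸ hlt).le, h.2.2⟩))

include hD in
theorem locallyCompactSpace : LocallyCompactSpace (Omega1 × ℕ) := by
  have := t2Space hD
  have : WeaklyLocallyCompactSpace (Omega1 × ℕ) :=
    ⟨fun z => ⟨_, isCompact_nbhd hD z, (isClopen_nbhd hD z 0).isOpen.mem_nhds (self_mem_nbhd z 0)⟩⟩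
  infer_instance

include hD in
theorem isOpen_lt_level (α : Omega1) : IsOpen {z : Omega1 × ℕ | z.1 < α} :=
  (hD _).2 fun _ hz => ⟨0, fun _ hw => (le_of_mem_nbhd hw).trans_lt hz⟩

include hD in
/-- A set of the list `G` below level `α` accumulates at all points of level `α`, unless finitely
many basic neighbourhoods cover it. -/
theorem mem_closure_or_subset {α γ : Omega1} (hγ : γ ≤ α) {i : ℕ}
    (hG : G γ i ⊆ {z | z.1 < α}) :
    (∀ n, (α, n) ∈ closure (G γ i)) ∨
      ∃ F : Set (Omega1 × ℕ), F.Finite ∧ (∀ y ∈ F, y.1 < α) ∧ G γ i ⊆ ⋃ y ∈ F, D.nbhd y 0 := by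
  -- Infinitely many ranks give, by `col_spec`, points of every colour and arbitrarily large rank.
  -- Bounded ranks give a finite cover.
  by_cases h : (D.rank α '' (G γ i ∩ {z | z.1 < α})).Infinite
  · refine Or.inl fun n => mem_closure_iff_nhds.2 fun N hN => ?_
    obtain ⟨j, hj⟩ := (mem_nhds_iff_nbhd hD).1 hN
    obtain ⟨_, ⟨⟨z, hz, rfl⟩, hcol⟩, hlt⟩ := (D.col_spec α γ hγ i h n).exists_gt j
    exact ⟨z, hj (Or.inr ⟨hz.2, hlt.le, hcol⟩), hz.1⟩
  · rw [not_infinite] at h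
    obtain ⟨k, hk⟩ := h.bddAbove
    refine Or.inr ⟨_, D.finite_index_le α k, fun y hy => hy.1, fun z hz => ?_⟩
    obtain ⟨y, hy, hfy, hzy⟩ := exists_rank_eq (D := D) (hG hz)
    exact mem_biUnion (x := y) ⟨hy, hfy ▸ hk ⟨z, ⟨hz, hG hz⟩, rfl⟩⟩ hzy

include hD in
/-- A set of the list which accumulates at all points of level `γ` accumulates at all points of
higher level. -/
theorem forall_mem_closure {γ : Omega1} {i : ℕ} (hG : G γ i ⊆ {z | z.1 < γ})
    (h : ∀ n, (γ, n) ∈ closure (G γ i)) : ∀ α ≥ γ, ∀ n, (α, n) ∈ closure (G γ i) := by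
  intro α
  induction α using WellFoundedLT.induction with
  | ind α ih =>
    intro hα
    rcases hα.eq_or_lt with rfl | hlt
    · exact h
    rcases mem_closure_or_subset hD hα (hG.trans fun z hz => lt_of_lt_of_le hz hα) with h1 | h1
    · exact h1
    obtain ⟨F, hF, hFα, hsub⟩ := h1
    have hcl : closure (G γ i) ⊆ ⋃ y ∈ F, D.nbhd y 0 :=
      closure_minimal hsub (hF.isClosed_biUnion fun y _ => (isClopen_nbhd hD y 0).isClosed)
    -- By induction the closure contains all of level `β`, but neighbourhoods of finitely many
    -- points of level at most `β` contain only finitely many points of that level.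
    obtain ⟨β, hβα, hγβ, hβ⟩ : ∃ β < α, γ ≤ β ∧ ∀ y ∈ F, y.1 ≤ β := by
      obtain ⟨β, hβ, hmax⟩ := ((hF.image Prod.fst).insert γ).exists_maximal ⟨γ, mem_insert _ _⟩
      refine ⟨β, ?_, (le_total γ β).elim id (hmax (mem_insert _ _)), fun y hy =>
        (le_total y.1 β).elim id (hmax (mem_insert_of_mem _ ⟨y, hy, rfl⟩))⟩
      rcases hβ with rfl | ⟨y, hy, rfl⟩
      · exact hlt
      · exact hFα y hy
    exact (not_forall_mem_biUnion (D := D) hF hβ fun n => hcl (ih β hβα hγβ n)).elim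

include hD in
/-- A countable set which the list contains is contained in a compact set, or it has an accumulation
point outside of it. -/
theorem exists_accPt_or_isCompact {Q : Set (Omega1 × ℕ)} (hQ : Q.Countable)
    (hG : ∃ γ i, G γ i = Q) :
    (∃ z ∈ closure Q, z ∉ Q) ∨ ∃ K, IsCompact K ∧ Q ⊆ K := by
  obtain ⟨γ, i, rfl⟩ := hG
  obtain ⟨α, hα⟩ :=
    Omega1.exists_gt_of_countable ((hQ.image Prod.fst).union (countable_singleton γ))
  have hsub : G γ i ⊆ {z | z.1 < α} := fun z hz => hα _ (Or.inl ⟨z, hz, rfl⟩)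
  rcases mem_closure_or_subset hD (hα γ (Or.inr rfl)).le hsub with h | ⟨F, hF, -, h⟩
  · exact Or.inl ⟨(α, 0), h 0, fun h' => lt_irrefl α (hsub h')⟩
  · exact Or.inr ⟨_, hF.isCompact_biUnion fun y _ => isCompact_nbhd hD y, h⟩

include hD in
theorem isCompact_of_countable (hG : ∀ Q : Set (Omega1 × ℕ), Q.Countable → ∃ γ i, G γ i = Q)
    {Q : Set (Omega1 × ℕ)} (hQ : Q.Countable) (hQc : IsClosed Q) : IsCompact Q := by
  rcases exists_accPt_or_isCompact hD hQ (hG Q hQ) with ⟨z, hz, hzQ⟩ | ⟨K, hK, hQK⟩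
  · exact (hzQ (hQc.closure_subset hz)).elim
  · exact hK.of_isClosed_subset hQc hQK

include hD in
theorem exists_frequently (hG : ∀ Q : Set (Omega1 × ℕ), Q.Countable → ∃ γ i, G γ i = Q)
    (u : ℕ → Omega1 × ℕ) : ∃ z, ∀ N ∈ 𝓝 z, ∃ᶠ n in atTop, u n ∈ N := by
  have := t2Space hD
  rcases exists_accPt_or_isCompact hD (countable_range u) (hG _ (countable_range u)) with
    ⟨z, hz, hzQ⟩ | ⟨K, hK, hQK⟩
  · refine ⟨z, fun N hN => ?_⟩
    by_contra hcon
    obtain ⟨m, hm⟩ := eventually_atTop.1 (not_frequently.1 hcon)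
    have hfin : (u '' Iio m).Finite := (finite_Iio m).image u
    have hN' : N \ (u '' Iio m) ∈ 𝓝 z :=
      inter_mem hN (hfin.isClosed.isOpen_compl.mem_nhds fun ⟨n, _, hn⟩ => hzQ ⟨n, hn⟩)
    obtain ⟨_, ⟨hx, hx'⟩, ⟨n, rfl⟩⟩ := mem_closure_iff_nhds.1 hz _ hN'
    refine hm n ?_ hx
    by_contra! hlt
    exact hx' ⟨n, hlt, rfl⟩
  · obtain ⟨z, -, hz⟩ := hK.exists_mapClusterPt_of_frequently (f := u) (l := atTop)
      (Eventually.frequently (Eventually.of_forall fun n => hQK ⟨n, rfl⟩))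
    exact ⟨z, fun N hN => mapClusterPt_iff_frequently.1 hz N hN⟩

include hD in
-- Finitely many neighbourhoods of points below `γ` cannot cover the levels below `γ`, so this
-- listed set accumulates at level `γ` and above. It yields a countable dense set.
theorem dense_lt_level (hG : ∀ γ, ∃ i, G γ i = {z | z.1 < γ}) {γ : Omega1} (hγ : ∃ β, β < γ) :
    Dense {z : Omega1 × ℕ | z.1 < γ} := by
  obtain ⟨i, hi⟩ := hG γ
  have hcl : ∀ n, (γ, n) ∈ closure (G γ i) := by
    rcases mem_closure_or_subset (D := D) hD le_rfl hi.le with h | ⟨F, hF, hFγ, hsub⟩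
    · exact h
    exfalso
    obtain ⟨β₀, hβ₀⟩ := hγ
    obtain ⟨β, hβ, hmax⟩ := ((hF.image Prod.fst).insert β₀).exists_maximal ⟨β₀, mem_insert _ _⟩
    have hβγ : β < γ := by
      rcases hβ with rfl | ⟨y, hy, rfl⟩
      · exact hβ₀
      · exact hFγ y hy
    refine not_forall_mem_biUnion (D := D) hF (β := β) (fun y hy =>
      (le_total y.1 β).elim id (hmax (mem_insert_of_mem _ ⟨y, hy, rfl⟩))) fun n => hsub ?_
    rw [hi]
    exact hβγ
  rintro ⟨α, n⟩
  rw [← hi]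
  rcases lt_or_ge α γ with h | h
  · exact subset_closure (hi.ge h)
  · exact forall_mem_closure hD hi.le hcl α h n

end OstaszewskiData

/-! ### Ostaszewski's topology and its global properties -/

namespace OstaszewskiData

variable {G : Omega1 → ℕ → Set (Omega1 × ℕ)} {D : OstaszewskiData G}

/-- The topology of Ostaszewski's space. -/
@[reducible] def topology (D : OstaszewskiData G) : TopologicalSpace (Omega1 × ℕ) where
  IsOpen U := ∀ z ∈ U, ∃ j, D.nbhd z j ⊆ U
  isOpen_univ _ _ := ⟨0, subset_univ _⟩
  isOpen_inter U V hU hV z hz := by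
    obtain ⟨i, hi⟩ := hU z hz.1
    obtain ⟨j, hj⟩ := hV z hz.2
    exact ⟨max i j, subset_inter ((nbhd_anti z (le_max_left i j)).trans hi)
      ((nbhd_anti z (le_max_right i j)).trans hj)⟩
  isOpen_sUnion 𝒰 h z hz := by
    obtain ⟨U, hU, hzU⟩ := hz
    obtain ⟨j, hj⟩ := h U hU z hzU
    exact ⟨j, hj.trans (subset_sUnion_of_mem hU)⟩

/-- The sets that the list has to contain: the initial segments, all countable sets, and, for every
uncountable set, some subset of it which is unbounded in a limit level. -/
structure IsGuessing (G : Omega1 → ℕ → Set (Omega1 × ℕ)) : Prop where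
  initial : ∀ γ, ∃ i, G γ i = {z | z.1 < γ}
  countable : ∀ Q : Set (Omega1 × ℕ), Q.Countable → ∃ γ i, G γ i = Q
  uncountable : ∀ S : Set (Omega1 × ℕ), ¬ S.Countable → ∃ γ i, G γ i ⊆ S ∧ G γ i ⊆ {z | z.1 < γ} ∧
    (∃ β, β < γ) ∧ ∀ β < γ, ∃ z ∈ G γ i, β < z.1

variable [TopologicalSpace (Omega1 × ℕ)] (hD : D.Compatible) (hG : IsGuessing G)

include hD hG in
-- The guessed subset of `S` is unbounded below `γ`, so finitely many neighbourhoods of lower points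
-- do not cover it. It then accumulates at all points of level `γ` and above, and these lie in `S`.
theorem countable_compl_of_isClosed {S : Set (Omega1 × ℕ)} (hS : IsClosed S)
    (hSu : ¬ S.Countable) : Sᶜ.Countable := by
  obtain ⟨γ, i, hGS, hGγ, ⟨β₀, hβ₀⟩, hunb⟩ := hG.uncountable S hSu
  have hcl : ∀ n, (γ, n) ∈ closure (G γ i) := by
    rcases mem_closure_or_subset (D := D) hD le_rfl hGγ with h | ⟨F, hF, hFγ, hsub⟩
    · exact h
    exfalso
    obtain ⟨β, hβ, hmax⟩ := ((hF.image Prod.fst).insert β₀).exists_maximal ⟨β₀, mem_insert _ _⟩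
    have hβγ : β < γ := by
      rcases hβ with rfl | ⟨y, hy, rfl⟩
      · exact hβ₀
      · exact hFγ y hy
    obtain ⟨z, hz, hlt⟩ := hunb β hβγ
    obtain ⟨y, hy, hzy⟩ := mem_iUnion₂.1 (hsub hz)
    have : y.1 ≤ β := (le_total y.1 β).elim id (hmax (mem_insert_of_mem _ ⟨y, hy, rfl⟩))
    exact absurd hlt (not_lt.2 ((le_of_mem_nbhd hzy).trans this))
  refine (Omega1.countable_lt_level γ).mono fun z hz => ?_
  by_contra h
  exact hz (closure_minimal hGS hS (forall_mem_closure hD hGγ hcl z.1 (not_lt.1 h) z.2))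

include hD hG in
theorem normalSpace : NormalSpace (Omega1 × ℕ) := by
  have := t2Space hD
  have := locallyCompactSpace hD
  refine normalSpace_of_isCompact_or fun S T hS hT hST => ?_
  by_cases h : S.Countable
  · exact Or.inl (isCompact_of_countable hD hG.countable h hS)
  · refine Or.inr (isCompact_of_countable hD hG.countable ?_ hT)
    exact (countable_compl_of_isClosed hD hG hS h).mono hST.subset_compl_left

include hD hG in
theorem t6Space : T6Space (Omega1 × ℕ) := by
  have := t2Space hD
  have := normalSpace hD hG
  have : PerfectlyNormalSpace (Omega1 × ℕ) := by
    refine ⟨fun S hS => ?_⟩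
    by_cases h : S.Countable
    · obtain ⟨α, hα⟩ := Omega1.exists_gt_of_countable (h.image Prod.fst)
      -- A countable closed set is an open initial segment with countably many points removed.
      have hSα : S = {z | z.1 < α} ∩ ({z | z.1 < α} \ S)ᶜ := by
        ext z
        have : z ∈ S → z.1 < α := fun hz => hα _ ⟨z, hz, rfl⟩
        simp only [mem_inter_iff, mem_ofPred_eq, mem_compl_iff, Set.mem_sdiff]
        tauto
      rw [hSα]
      exact (isOpen_lt_level hD α).isGδ.inter
        ((Omega1.countable_lt_level α).mono sdiff_subset).isGδ_compl
    · have := (countable_compl_of_isClosed hD hG hS h).isGδ_compl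
      rwa [compl_compl] at this
  exact {}

include hD hG in
theorem linearlyHClosed : LinearlyHClosed (Omega1 × ℕ) := by
  have : Nonempty Omega1 := (inferInstance : Infinite Omega1).nonempty
  obtain ⟨γ, hγ⟩ := Omega1.exists_gt (Classical.arbitrary _)
  have hdense := dense_lt_level hD hG.initial ⟨_, hγ⟩
  have hctble := Omega1.countable_lt_level γ
  refine linearlyHClosed_of_weaklyLindelof_of_feeblyCompact (fun 𝒰 _ hc => ?_) fun V _ hne => ?_
  · have : ∀ z : Omega1 × ℕ, ∃ U ∈ 𝒰, z ∈ U := fun z => by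
      simpa using (hc ▸ mem_univ z : z ∈ ⋃₀ 𝒰)
    choose U hU hzU using this
    exact ⟨U '' {z | z.1 < γ}, image_subset_iff.2 fun z _ => hU z, hctble.image U,
      hdense.mono fun z hz => ⟨U z, ⟨z, hz, rfl⟩, hzU z⟩⟩
  · choose u hu using hne
    obtain ⟨z, hz⟩ := exists_frequently hD hG.countable u
    exact ⟨z, fun N hN => (hz N hN).mono fun n hn => ⟨u n, hu n, hn⟩⟩

include hD in
theorem not_compactSpace : ¬ CompactSpace (Omega1 × ℕ) := by
  intro h
  obtain ⟨t, ht⟩ := isCompact_univ.elim_finite_subcover (fun α => {z : Omega1 × ℕ | z.1 < α})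
    (isOpen_lt_level hD) fun z _ => by
      obtain ⟨α, hα⟩ := Omega1.exists_gt z.1
      exact mem_iUnion.2 ⟨α, hα⟩
  obtain ⟨β, hβ⟩ := Omega1.exists_gt_of_countable t.countable_toSet
  obtain ⟨α, hα, h⟩ := mem_iUnion₂.1 (ht (mem_univ (β, 0)))
  exact lt_asymm (hβ α hα) h

end OstaszewskiData

/-! ### Guessing countable and uncountable sets by means of ◇ -/

theorem Omega1.isClub_limits {S : Set Omega1} (hS : ¬ S.Countable) :
    IsClub {γ | (∃ β, β < γ) ∧ ∀ β < γ, ∃ ξ ∈ S, β < ξ ∧ ξ < γ} := by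
  constructor
  · rintro d hd ⟨x, hx⟩ - a ha
    obtain ⟨β, hβ⟩ := (hd hx).1
    refine ⟨⟨β, hβ.trans_le (ha.1 hx)⟩, fun β hβ => ?_⟩
    obtain ⟨y, hy, hβy⟩ := (lt_isLUB_iff ha).1 hβ
    obtain ⟨ξ, h1, h2, h3⟩ := (hd hy).2 β hβy
    exact ⟨ξ, h1, h2, h3.trans_le (ha.1 hy)⟩
  · intro a
    have hex : ∀ b : Omega1, ∃ ξ ∈ S, b < ξ := by
      intro b
      by_contra! h
      exact hS ((Omega1.countable_Iic b).mono h)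
    choose g hgS hg using hex
    let u : ℕ → Omega1 := fun n => g^[n] a
    have hsucc : ∀ n, u (n + 1) = g (u n) := fun n => Function.iterate_succ_apply' _ _ _
    obtain ⟨γ, hγ⟩ := Omega1.exists_isLUB_of_countable (countable_range u)
    have hlt : ∀ n, u n < γ := fun n => by
      refine lt_of_lt_of_le ?_ (hγ.1 ⟨n + 1, rfl⟩)
      rw [hsucc]
      exact hg _
    refine ⟨γ, ⟨⟨a, hlt 0⟩, fun β hβ => ?_⟩, (hlt 0).le⟩
    obtain ⟨_, ⟨n, rfl⟩, hn⟩ := (lt_isLUB_iff hγ).1 hβ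
    refine ⟨g (u n), hgS _, hn.trans (hg _), ?_⟩
    rw [← hsucc]
    exact hlt _

theorem Omega1.isClub_Ioi (a : Omega1) : IsClub (Ioi a) := by
  constructor
  · rintro d hd ⟨x, hx⟩ - b hb
    exact lt_of_lt_of_le (hd hx) (hb.1 hx)
  · intro b
    obtain ⟨c, hc⟩ := Omega1.exists_gt (max a b)
    exact ⟨c, (le_max_left a b).trans_lt hc, ((le_max_right a b).trans_lt hc).le⟩

theorem exists_isGuessing (h : DiamondPrinciple) :
    ∃ G : Omega1 → ℕ → Set (Omega1 × ℕ), OstaszewskiData.IsGuessing G := by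
  obtain ⟨A, hA, hst⟩ := h
  obtain ⟨ι⟩ : Nonempty (Omega1 × ℕ ≃ Omega1) := Cardinal.eq.1 (by
    rw [Cardinal.mk_prod, Cardinal.lift_id, Cardinal.lift_id, Omega1.mk_eq, Cardinal.mk_nat]
    exact Cardinal.mul_eq_left (Cardinal.aleph0_le_aleph 1) (Cardinal.aleph0_le_aleph 1)
      Cardinal.aleph0_ne_zero)
  -- Row 1 reaches every countable set, as its code is bounded and is guessed beyond the bound. Rows
  -- `n + 2` serve uncountable sets: some column is uncountable, and it is guessed at one of its
  -- limits.
  let G : Omega1 → ℕ → Set (Omega1 × ℕ) := fun γ i => match i with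
    | 0 => {z | z.1 < γ}
    | 1 => {z | ι z ∈ A γ}
    | n + 2 => {z | z.1 ∈ A γ ∧ z.2 = n}
  refine ⟨G, fun γ => ⟨0, rfl⟩, fun Q hQ => ?_, fun S hS => ?_⟩
  · obtain ⟨β, hβ⟩ := Omega1.exists_gt_of_countable (hQ.image ι)
    obtain ⟨γ, hγ, hβγ⟩ := hst (ι '' Q) (Omega1.isClub_Ioi β)
    refine ⟨γ, 1, ?_⟩
    ext z
    change ι z ∈ A γ ↔ z ∈ Q
    rw [← (show ι '' Q ∩ Iio γ = A γ from hγ)]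
    constructor
    · rintro ⟨h, -⟩
      exact (ι.injective.mem_set_image).1 h
    · exact fun h => ⟨⟨z, h, rfl⟩, (hβ _ ⟨z, h, rfl⟩).trans hβγ⟩
  · obtain ⟨n, hn⟩ : ∃ n, ¬ {β | (β, n) ∈ S}.Countable := by
      by_contra! hcon
      refine hS ((countable_iUnion fun n => (hcon n).image fun β => (β, n)).mono fun z hz => ?_)
      exact mem_iUnion.2 ⟨z.2, z.1, hz, rfl⟩
    obtain ⟨γ, hγ, hpos, hlim⟩ := hst {β | (β, n) ∈ S} (Omega1.isClub_limits hn)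
    have hAγ : {β | (β, n) ∈ S} ∩ Iio γ = A γ := hγ
    refine ⟨γ, n + 2, ?_, ?_, hpos, fun β hβ => ?_⟩
    · rintro ⟨β, m⟩ ⟨hβ, hm⟩
      rw [← hAγ] at hβ
      simp only at hm
      subst hm
      exact hβ.1
    · exact fun z hz => hA γ hz.1
    · obtain ⟨ξ, hξ, h1, h2⟩ := hlim β hβ
      exact ⟨(ξ, n), ⟨hAγ ▸ ⟨hξ, h2⟩, rfl⟩, h1⟩

theorem exists_ostaszewski_space (h : DiamondPrinciple) :
    ∃ (X : Type) (_ : TopologicalSpace X), LinearlyHClosed X ∧ ¬ CompactSpace X ∧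
      FirstCountableTopology X ∧ LocallyCompactSpace X ∧ T6Space X := by
  obtain ⟨G, hG⟩ := exists_isGuessing h
  obtain ⟨D⟩ := nonempty_ostaszewskiData G
  let := D.topology
  have hD : D.Compatible := fun _ => Iff.rfl
  exact ⟨Omega1 × ℕ, D.topology, D.linearlyHClosed hD hG, D.not_compactSpace hD,
    D.firstCountableTopology hD, D.locallyCompactSpace hD, D.t6Space hD hG⟩

/-! ### Collectionwise normality of countably compact normal spaces -/

theorem IsDiscreteCollection.eq_of_mem {X : Type u} [TopologicalSpace X] {𝓕 : Set (Set X)}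
    (h : IsDiscreteCollection 𝓕) {F G : Set X} (hF : F ∈ 𝓕) (hG : G ∈ 𝓕) {x : X} (hxF : x ∈ F)
    (hxG : x ∈ G) : F = G := by
  obtain ⟨N, hN, hs⟩ := h x
  exact hs ⟨hF, x, hxF, mem_of_mem_nhds hN⟩ ⟨hG, x, hxG, mem_of_mem_nhds hN⟩

/-- Points picked from infinitely many members would cluster, and near the cluster point two members
would meet every neighbourhood. -/
theorem IsDiscreteCollection.finite_nonempty {X : Type u} [TopologicalSpace X] {𝓕 : Set (Set X)}
    (hcc : ∀ x : ℕ → X, ∃ a, MapClusterPt a atTop x) (h : IsDiscreteCollection 𝓕) :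
    {F ∈ 𝓕 | F.Nonempty}.Finite := by
  by_contra hinf
  let e := Set.Infinite.natEmbedding _ hinf
  choose x hx using fun n => (e n).2.2
  obtain ⟨a, ha⟩ := hcc x
  obtain ⟨N, hN, hs⟩ := h a
  have hfr := frequently_atTop.1 (mapClusterPt_iff_frequently.1 ha N hN)
  obtain ⟨n, -, hn⟩ := hfr 0
  obtain ⟨m, hnm, hm⟩ := hfr (n + 1)
  have := hs ⟨(e n).2.1, x n, hx n, hn⟩ ⟨(e m).2.1, x m, hx m, hm⟩
  have := e.injective (Subtype.ext this)
  omega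

theorem collectionwiseNormal_of_countablyCompact {X : Type u} [TopologicalSpace X] [T2Space X]
    [NormalSpace X] (hcc : ∀ x : ℕ → X, ∃ a, MapClusterPt a atTop x) :
    CollectionwiseNormal X := by
  refine ⟨inferInstance, fun 𝓕 hcl hd => ?_⟩
  set 𝓖 := {F ∈ 𝓕 | F.Nonempty} with h𝓖
  have hfin : 𝓖.Finite := hd.finite_nonempty hcc
  have hsep : ∀ F ∈ 𝓖, ∃ u : Set X, IsOpen u ∧ F ⊆ u ∧ closure u ⊆ (⋃₀ (𝓖 \ {F}))ᶜ := by
    intro F hF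
    refine normal_exists_closure_subset (hcl F hF.1) (IsClosed.isOpen_compl (self := ?_)) ?_
    · rw [sUnion_eq_biUnion]
      exact (hfin.subset sdiff_subset).isClosed_biUnion fun G hG => hcl G hG.1.1
    · rintro x hx ⟨G, hG, hxG⟩
      exact hG.2 (hd.eq_of_mem hG.1.1 hF.1 hxG hx)
  choose! u hu hFu huc using hsep
  -- Removing the closures of the other `u G` makes the sets disjoint and costs `F` nothing, since
  -- those closures avoid it. Empty members receive the empty set.
  refine ⟨fun F => {x | F ∈ 𝓖 ∧ x ∈ u F ∧ x ∉ ⋃ G ∈ 𝓖 \ {F}, closure (u G)},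
    fun F hF => ⟨?_, ?_⟩, ?_⟩
  · by_cases hF' : F ∈ 𝓖
    · have : IsClosed (⋃ G ∈ 𝓖 \ {F}, closure (u G)) :=
        (hfin.subset sdiff_subset).isClosed_biUnion fun _ _ => isClosed_closure
      convert (hu F hF').inter this.isOpen_compl using 1
      ext x
      exact ⟨fun hx => hx.2, fun hx => ⟨hF', hx⟩⟩
    · convert isOpen_empty
      ext x
      exact ⟨fun hx => hF' hx.1, False.elim⟩
  · intro x hx
    have hF' : F ∈ 𝓖 := ⟨hF, x, hx⟩
    refine ⟨hF', hFu F hF' hx, ?_⟩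
    rw [mem_iUnion₂]
    rintro ⟨G, hG, hxG⟩
    exact huc G hG.1 hxG ⟨F, ⟨hF', fun h => hG.2 h.symm⟩, hx⟩
  · intro F _ G _ hFG
    refine disjoint_left.2 fun x hx hy => ?_
    exact hx.2.2 (mem_biUnion ⟨hy.1, fun h => hFG h.symm⟩ (subset_closure hy.2.1))

/-! ### The `Σ`-product -/

theorem Set.Countable.finset_coe_subset {I : Type u} {J : Set I} (hJ : J.Countable) :
    {F : Finset I | ↑F ⊆ J}.Countable := by
  refine ((countable_ofPred_finite_subset hJ).preimage_of_injOn
    (Finset.coe_injective.injOn)).mono fun F hF => ?_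
  exact ⟨F.finite_toSet, hF⟩

theorem exists_countable_closed_under {I : Type u} (g : Finset I → Set I)
    (hg : ∀ F, (g F).Countable) {J₀ : Set I} (h₀ : J₀.Countable) :
    ∃ J : Set I, J.Countable ∧ J₀ ⊆ J ∧ ∀ F : Finset I, ↑F ⊆ J → g F ⊆ J := by
  let s : ℕ → Set I := fun n => n.rec J₀ fun _ J => J ∪ ⋃ F ∈ {F : Finset I | ↑F ⊆ J}, g F
  have hs : ∀ n, s (n + 1) = s n ∪ ⋃ F ∈ {F : Finset I | ↑F ⊆ s n}, g F := fun _ => rfl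
  have hc : ∀ n, (s n).Countable := by
    intro n
    induction n with
    | zero => exact h₀
    | succ n ih =>
      rw [hs]
      exact ih.union (ih.finset_coe_subset.biUnion fun F _ => hg F)
  have hmono : Monotone s := monotone_nat_of_le_succ fun n => by
    rw [hs]; exact subset_union_left
  refine ⟨⋃ n, s n, countable_iUnion hc, subset_iUnion s 0, fun F hF => ?_⟩
  obtain ⟨n, hn⟩ : ∃ n, ↑F ⊆ s n := hmono.directed_le.exists_mem_subset_of_finset_subset_biUnion hF
  refine Subset.trans ?_ (subset_iUnion s (n + 1))
  rw [hs]
  exact subset_union_of_subset_right (subset_biUnion_of_mem (u := g) hn) _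

theorem Set.Countable.exists_finset_exhaustion {I : Type u} {J : Set I} (hJ : J.Countable) :
    ∃ F : ℕ → Finset I, (∀ n, ↑(F n) ⊆ J) ∧ ∀ i ∈ J, ∀ᶠ n in atTop, i ∈ F n := by
  classical
  rcases J.eq_empty_or_nonempty with rfl | hne
  · exact ⟨fun _ => ∅, by simp, by simp⟩
  · obtain ⟨f, rfl⟩ := hJ.exists_eq_range hne
    refine ⟨fun n => (Finset.range n).image f, fun n => ?_, ?_⟩
    · rw [Finset.coe_image]
      exact image_subset_range _ _
    · rintro _ ⟨k, rfl⟩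
      filter_upwards [eventually_gt_atTop k] with n hn
      exact Finset.mem_image_of_mem _ (Finset.mem_range.2 hn)

namespace SigmaProduct

variable {I : Type u}

/-- The set of coordinates at which a point of the `Σ`-product has value `1`. -/
def support (x : SigmaProduct I) : Set I := {i | x.1 i = true}

theorem countable_support (x : SigmaProduct I) : (support x).Countable := x.2

theorem apply_eq_false {x : SigmaProduct I} {J : Set I} (h : support x ⊆ J) {i : I} (hi : i ∉ J) :
    x.1 i = false :=
  Bool.eq_false_of_not_eq_true fun h' => hi (h h')

/-- The point of the `Σ`-product that is the characteristic function of a countable set. -/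
noncomputable def ofSupport (s : Set I) (hs : s.Countable) : SigmaProduct I := by
  classical
  exact ⟨fun i => decide (i ∈ s), by simpa [SigmaProduct] using hs⟩

theorem ofSupport_apply {s : Set I} (hs : s.Countable) (i : I) :
    (ofSupport s hs).1 i = true ↔ i ∈ s := by
  simp [ofSupport]

theorem mem_nhds_iff {x : SigmaProduct I} {N : Set (SigmaProduct I)} :
    N ∈ 𝓝 x ↔ ∃ F : Finset I, {y : SigmaProduct I | ∀ i ∈ F, y.1 i = x.1 i} ⊆ N := by
  rw [nhds_subtype_eq_comap, mem_comap]
  constructor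
  · rintro ⟨t, ht, htN⟩
    rw [nhds_pi, Filter.mem_pi] at ht
    obtain ⟨J, hJ, s, hs, hst⟩ := ht
    refine ⟨hJ.toFinset, fun y hy => htN (hst fun i hi => ?_)⟩
    rw [hy i (hJ.mem_toFinset.2 hi)]
    exact mem_of_mem_nhds (hs i)
  · rintro ⟨F, hF⟩
    refine ⟨(F : Set I).pi fun i => {x.1 i}, ?_, fun y hy => hF fun i hi => hy i hi⟩
    exact set_pi_mem_nhds F.finite_toSet fun i _ => by simp

theorem mem_closure_iff {x : SigmaProduct I} {A : Set (SigmaProduct I)} :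
    x ∈ closure A ↔ ∀ F : Finset I, ∃ a ∈ A, ∀ i ∈ F, a.1 i = x.1 i := by
  rw [mem_closure_iff_nhds]
  constructor
  · intro h F
    obtain ⟨a, ha, haA⟩ := h _ (mem_nhds_iff.2 ⟨F, Subset.rfl⟩)
    exact ⟨a, haA, ha⟩
  · intro h N hN
    obtain ⟨F, hF⟩ := mem_nhds_iff.1 hN
    obtain ⟨a, haA, ha⟩ := h F
    exact ⟨a, hF ha, haA⟩

theorem isCompact_support_subset {J : Set I} (hJ : J.Countable) :
    IsCompact {x : SigmaProduct I | support x ⊆ J} := by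
  rw [Subtype.isCompact_iff]
  have : Subtype.val '' {x : SigmaProduct I | support x ⊆ J} =
      Jᶜ.pi fun _ => ({false} : Set Bool) := by
    ext x
    constructor
    · rintro ⟨x, hx, rfl⟩ i hi
      exact apply_eq_false hx hi
    · intro hx
      have hxJ : {i | x i = true} ⊆ J := fun i hi => by
        by_contra h
        have h1 : x i = false := hx i h
        have h2 : x i = true := hi
        simp [h1] at h2
      exact ⟨⟨x, hJ.mono hxJ⟩, hxJ, rfl⟩
  rw [this]
  exact (isClosed_set_pi fun _ _ => isClosed_discrete _).isCompact

theorem exists_mapClusterPt (x : ℕ → SigmaProduct I) : ∃ a, MapClusterPt a atTop x := by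
  obtain ⟨a, -, ha⟩ := (isCompact_support_subset (countable_iUnion fun n =>
    countable_support (x n))).exists_mapClusterPt_of_frequently (f := x) (l := atTop)
      (Frequently.of_forall fun n => subset_iUnion (fun n => support (x n)) n)
  exact ⟨a, ha⟩

theorem exists_countable_dense_sUnion (𝒰 : Set (Set (SigmaProduct I)))
    (ho : ∀ U ∈ 𝒰, IsOpen U) (hc : ⋃₀ 𝒰 = univ) : ∃ 𝒱 ⊆ 𝒰, 𝒱.Countable ∧ Dense (⋃₀ 𝒱) := by
  classical
  have h1 : ∀ x : SigmaProduct I, ∃ U ∈ 𝒰, ∃ F : Finset I,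
      {y : SigmaProduct I | ∀ i ∈ F, y.1 i = x.1 i} ⊆ U := by
    intro x
    obtain ⟨U, hU, hx⟩ : x ∈ ⋃₀ 𝒰 := hc ▸ mem_univ x
    exact ⟨U, hU, mem_nhds_iff.1 ((ho U hU).mem_nhds hx)⟩
  choose U hU F hF using h1
  let p : Finset I → SigmaProduct I := fun T => ofSupport T T.countable_toSet
  obtain ⟨J, hJ, -, hJF⟩ := exists_countable_closed_under (fun T => (F (p T) : Set I))
    (fun T => Finset.countable_toSet _) countable_empty
  refine ⟨(fun T => U (p T)) '' {T : Finset I | ↑T ⊆ J}, ?_, ?_, ?_⟩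
  · rintro _ ⟨T, -, rfl⟩
    exact hU _
  · exact hJ.finset_coe_subset.image _
  · intro y
    refine mem_closure_iff.2 fun S => ?_
    -- The point `p Z` copies `y` on `S`. It agrees with `p T` on `J`, which contains `F (p T)`, so
    -- it lies in `U (p T)`.
    let T := S.filter fun i => i ∈ J ∧ y.1 i = true
    let Z := S.filter fun i => y.1 i = true
    have hT : (T : Set I) ⊆ J := fun i hi => (Finset.mem_filter.1 hi).2.1
    refine ⟨p Z, ⟨_, ⟨T, hT, rfl⟩, hF _ fun i hi => ?_⟩, fun i hi => ?_⟩
    · have hiJ : i ∈ J := hJF T hT hi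
      rw [Bool.eq_iff_iff, ofSupport_apply, ofSupport_apply]
      simp [Z, T, hiJ]
    · rw [Bool.eq_iff_iff, ofSupport_apply]
      simp [Z, hi]

theorem linearlyHClosed : LinearlyHClosed (SigmaProduct I) := by
  have : Nonempty (SigmaProduct I) := ⟨ofSupport ∅ countable_empty⟩
  refine linearlyHClosed_of_weaklyLindelof_of_feeblyCompact exists_countable_dense_sUnion
    fun V _ hV => ?_
  choose x hx using hV
  obtain ⟨a, ha⟩ := exists_mapClusterPt x
  exact ⟨a, fun N hN => (mapClusterPt_iff_frequently.1 ha N hN).mono fun n hn => ⟨x n, hx n, hn⟩⟩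

/-- Characteristic functions of finite sets approximate the constant `true`, which a compact, hence
closed, `Σ`-product would have to contain. -/
theorem not_compactSpace [Uncountable I] : ¬ CompactSpace (SigmaProduct I) := by
  intro h
  have hcl : IsClosed (SigmaProduct I) := (isCompact_iff_compactSpace.2 h).isClosed
  have hmem : (fun _ => true : I → Bool) ∈ closure (SigmaProduct I) := by
    classical
    rw [mem_closure_iff_nhds]
    intro N hN
    rw [nhds_pi, Filter.mem_pi] at hN
    obtain ⟨J, hJ, s, hs, hst⟩ := hN
    refine ⟨(ofSupport J hJ.countable).1, hst fun i hi => ?_, (ofSupport J hJ.countable).2⟩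
    rw [(ofSupport_apply hJ.countable i).2 hi]
    exact mem_of_mem_nhds (hs i)
  rw [hcl.closure_eq] at hmem
  refine not_countable_univ (α := I) (hmem.mono fun i _ => rfl)

/-- The points `a F` of `A` agree with `x` on `F`. Along finite sets exhausting a countable `J`
closed under supports of the `a F`, they converge on `J`; off `J` everything vanishes. -/
theorem frechetUrysohnSpace : FrechetUrysohnSpace (SigmaProduct I) := by
  refine ⟨fun A x hx => ?_⟩
  choose a haA ha using mem_closure_iff.1 hx
  obtain ⟨J, hJ, hxJ, haJ⟩ := exists_countable_closed_under (fun F => support (a F))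
    (fun F => countable_support _) (countable_support x)
  obtain ⟨F, hFJ, hF⟩ := hJ.exists_finset_exhaustion
  refine ⟨fun n => a (F n), fun n => haA _, ?_⟩
  rw [tendsto_subtype_rng, tendsto_pi_nhds]
  intro i
  refine tendsto_nhds_of_eventually_eq ?_
  by_cases hi : i ∈ J
  · filter_upwards [hF i hi] with n hn
    exact ha _ i hn
  · refine Eventually.of_forall fun n => ?_
    rw [apply_eq_false hxJ hi, apply_eq_false (haJ _ (hFJ n)) hi]

open Classical in
/-- The retraction of the `Σ`-product that makes all coordinates outside a given set vanish. -/
noncomputable def retract (J : Set I) (x : SigmaProduct I) : SigmaProduct I :=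
  ⟨fun i => if i ∈ J then x.1 i else false, x.2.mono fun i hi => by
    by_contra h
    by_cases hJ : i ∈ J <;> simp_all⟩

theorem retract_apply_of_mem {J : Set I} (x : SigmaProduct I) {i : I} (hi : i ∈ J) :
    (retract J x).1 i = x.1 i := if_pos hi

theorem retract_apply_of_notMem {J : Set I} (x : SigmaProduct I) {i : I} (hi : i ∉ J) :
    (retract J x).1 i = false := if_neg hi

theorem support_retract_subset (J : Set I) (x : SigmaProduct I) : support (retract J x) ⊆ J := by
  intro i hi
  by_contra h
  have h1 : (retract J x).1 i = true := hi
  rw [retract_apply_of_notMem x h] at h1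
  exact Bool.false_ne_true h1

theorem continuous_retract (J : Set I) : Continuous (retract J) := by
  refine Continuous.subtype_mk (continuous_pi fun i => ?_) _
  by_cases hi : i ∈ J
  · simp only [hi, if_true]
    exact (continuous_apply i).comp continuous_subtype_val
  · simp only [hi, if_false]
    exact continuous_const

/-- For a closed set `H` the retractions onto suitably closed-off countable sets of coordinates
map `H` into itself. -/
theorem exists_forall_retract_mem {H : Set (SigmaProduct I)} (hH : IsClosed H) :
    ∃ g : Finset I → Set I, (∀ F, (g F).Countable) ∧
      ∀ J : Set I, (∀ F : Finset I, ↑F ⊆ J → g F ⊆ J) → ∀ x ∈ H, retract J x ∈ H := by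
  classical
  have h : ∀ F T : Finset I, ∃ y : SigmaProduct I,
      (∃ x ∈ H, ∀ i ∈ F, x.1 i = true ↔ i ∈ T) → y ∈ H ∧ ∀ i ∈ F, y.1 i = true ↔ i ∈ T := by
    intro F T
    by_cases hx : ∃ x ∈ H, ∀ i ∈ F, x.1 i = true ↔ i ∈ T
    · obtain ⟨x, hx⟩ := hx
      exact ⟨x, fun _ => hx⟩
    · exact ⟨ofSupport ∅ countable_empty, fun h => (hx h).elim⟩
  -- `y F T` realizes the pattern `T` on `F` inside `H` whenever some point of `H` does. If `J`
  -- contains its support, it also agrees with the retracted point off `J`.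
  choose y hy using h
  refine ⟨fun F => ⋃ T ∈ (F.powerset : Set (Finset I)), support (y F T), fun F =>
    (Finset.countable_toSet _).biUnion fun T _ => countable_support _, fun J hJ x hx => ?_⟩
  rw [← hH.closure_eq]
  refine mem_closure_iff.2 fun F => ?_
  let F' := F.filter (· ∈ J)
  let T := F'.filter fun i => x.1 i = true
  obtain ⟨h1, h2⟩ := hy F' T ⟨x, hx, fun i hi => by simp [T, hi]⟩
  have hF' : (F' : Set I) ⊆ J := fun i hi => (Finset.mem_filter.1 hi).2
  have h3 : support (y F' T) ⊆ J :=
    Subset.trans (subset_biUnion_of_mem (u := fun T => support (y F' T))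
      (Finset.mem_coe.2 (Finset.mem_powerset.2 (Finset.filter_subset _ _)))) (hJ F' hF')
  refine ⟨_, h1, fun i hi => ?_⟩
  by_cases hiJ : i ∈ J
  · have hi' : i ∈ F' := Finset.mem_filter.2 ⟨hi, hiJ⟩
    rw [retract_apply_of_mem x hiJ, Bool.eq_iff_iff, h2 i hi']
    simp [T, hi']
  · rw [retract_apply_of_notMem x hiJ, apply_eq_false h3 hiJ]

/-- One retraction maps both closed sets into their own traces on a compact subspace; disjoint open
sets there pull back. -/
theorem normalSpace : NormalSpace (SigmaProduct I) := by
  refine ⟨fun H K hH hK hHK => ?_⟩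
  obtain ⟨g, hgc, hg⟩ := exists_forall_retract_mem hH
  obtain ⟨k, hkc, hk⟩ := exists_forall_retract_mem hK
  obtain ⟨J, hJ, -, hJc⟩ := exists_countable_closed_under (fun F => g F ∪ k F)
    (fun F => (hgc F).union (hkc F)) countable_empty
  have hc := isCompact_support_subset hJ
  obtain ⟨U, V, hU, hV, hHU, hKV, hUV⟩ := SeparatedNhds.of_isCompact_isCompact
    (hc.inter_right hH) (hc.inter_right hK) (hHK.mono inter_subset_right inter_subset_right)
  refine ⟨retract J ⁻¹' U, retract J ⁻¹' V, hU.preimage (continuous_retract J),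
    hV.preimage (continuous_retract J), fun x hx => hHU ⟨support_retract_subset J x, ?_⟩,
    fun x hx => hKV ⟨support_retract_subset J x, ?_⟩, hUV.preimage _⟩
  · exact hg J (fun F hF => subset_union_left.trans (hJc F hF)) x hx
  · exact hk J (fun F hF => subset_union_right.trans (hJc F hF)) x hx

theorem collectionwiseNormal : CollectionwiseNormal (SigmaProduct I) :=
  have := normalSpace (I := I)
  collectionwiseNormal_of_countablyCompact exists_mapClusterPt

end SigmaProduct

/-! ### Maximal almost disjoint families and the spaces `Ψ(𝒜)` -/

theorem isAlmostDisjoint_range_pair :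
    IsAlmostDisjoint (range fun i : ℕ => range (Nat.pair i)) := by
  refine ⟨?_, ?_⟩
  · rintro _ ⟨i, rfl⟩
    exact infinite_range_of_injective fun a b h => (Nat.pair_eq_pair.1 h).2
  · rintro _ ⟨i, rfl⟩ _ ⟨j, rfl⟩ hij
    convert finite_empty
    refine eq_empty_of_forall_notMem ?_
    rintro _ ⟨⟨a, rfl⟩, b, hb⟩
    exact hij (by rw [(Nat.pair_eq_pair.1 hb).1])

theorem IsAlmostDisjoint.exists_maximal {𝒜₀ : Set (Set ℕ)} (h₀ : IsAlmostDisjoint 𝒜₀) :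
    ∃ 𝒜, 𝒜₀ ⊆ 𝒜 ∧ Maximal IsAlmostDisjoint 𝒜 := by
  refine zorn_subset_nonempty {𝒜 | IsAlmostDisjoint 𝒜} (fun c hc hchain _ =>
    ⟨⋃₀ c, ⟨?_, ?_⟩, fun s hs => subset_sUnion_of_mem hs⟩) 𝒜₀ h₀
  · rintro A ⟨s, hs, hA⟩
    exact (hc hs).1 A hA
  · rintro A ⟨s, hs, hA⟩ B ⟨t, ht, hB⟩ hAB
    rcases hchain.total hs ht with h | h
    · exact (hc ht).2 A (h hA) B hB hAB
    · exact (hc hs).2 A hA B (h hB) hAB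

theorem exists_isInfiniteMAD : ∃ 𝒜 : Set (Set ℕ), IsInfiniteMAD 𝒜 := by
  obtain ⟨𝒜, h, hmax⟩ := isAlmostDisjoint_range_pair.exists_maximal
  refine ⟨𝒜, (infinite_range_of_injective fun i j hij => ?_).mono h, hmax⟩
  obtain ⟨b, hb⟩ : Nat.pair i 0 ∈ range (Nat.pair j) := by
    rw [← show range (Nat.pair i) = range (Nat.pair j) from hij]
    exact ⟨0, rfl⟩
  exact (Nat.pair_eq_pair.1 hb).1.symm

/-- Otherwise `S` could be added to the family, so it is a member by maximality, and its
intersection with itself is infinite. -/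
theorem exists_infinite_inter_of_maximal {𝒜 : Set (Set ℕ)} (h : Maximal IsAlmostDisjoint 𝒜)
    {S : Set ℕ} (hS : S.Infinite) : ∃ A ∈ 𝒜, (A ∩ S).Infinite := by
  by_contra! hcon
  have hins : IsAlmostDisjoint (insert S 𝒜) := by
    refine ⟨?_, ?_⟩
    · rintro A (rfl | hA)
      · exact hS
      · exact h.1.1 A hA
    · rintro A (rfl | hA) B (rfl | hB) hAB
      · exact (hAB rfl).elim
      · rw [inter_comm]
        exact hcon B hB
      · exact hcon A hA
      · exact h.1.2 A hA B hB hAB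
  have := hcon S (h.2 hins (subset_insert S 𝒜) (mem_insert S 𝒜))
  rw [inter_self] at this
  exact hS this

namespace IsbellPsi

variable {𝒜 : Set (Set ℕ)}

/-- The isolated points of `Ψ(𝒜)`. -/
def ofNat (n : ℕ) : IsbellPsi 𝒜 := Sum.inl n

/-- The point of `Ψ(𝒜)` given by a member of `𝒜`. -/
def ofMem (A : 𝒜) : IsbellPsi 𝒜 := Sum.inr A

theorem eq_ofNat_or_ofMem (x : IsbellPsi 𝒜) : (∃ n, x = ofNat n) ∨ ∃ A, x = ofMem A := by
  rcases x with n | A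
  · exact Or.inl ⟨n, rfl⟩
  · exact Or.inr ⟨A, rfl⟩

theorem ofNat_injective : Function.Injective (ofNat : ℕ → IsbellPsi 𝒜) := Sum.inl_injective

theorem ofMem_injective : Function.Injective (ofMem : 𝒜 → IsbellPsi 𝒜) := Sum.inr_injective

theorem ofNat_ne_ofMem (n : ℕ) (A : 𝒜) : ofNat n ≠ ofMem A := Sum.inl_ne_inr

theorem isOpen_iff {U : Set (IsbellPsi 𝒜)} :
    IsOpen U ↔ ∀ A : 𝒜, ofMem A ∈ U → {n ∈ (A : Set ℕ) | ofNat n ∉ U}.Finite := Iff.rfl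

theorem isOpen_of_forall_notMem {U : Set (IsbellPsi 𝒜)} (h : ∀ A : 𝒜, ofMem A ∉ U) : IsOpen U :=
  isOpen_iff.2 fun A hA => (h A hA).elim

theorem isClosed_of_forall_notMem {C : Set (IsbellPsi 𝒜)} (h : ∀ n, ofNat n ∉ C) : IsClosed C := by
  refine ⟨isOpen_iff.2 fun A _ => finite_empty.subset ?_⟩
  rintro n ⟨-, hn⟩
  exact hn (h n)

theorem isClopen_singleton_ofNat (n : ℕ) : IsClopen {(ofNat n : IsbellPsi 𝒜)} := by
  refine ⟨⟨isOpen_iff.2 fun A _ => (finite_singleton n).subset ?_⟩,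
    isOpen_of_forall_notMem fun A hA => ofNat_ne_ofMem n A hA.symm⟩
  rintro k ⟨-, hk⟩
  exact ofNat_injective (not_not.1 hk)

/-- The basic neighbourhood `{A} ∪ (A \ F)` of a member `A` of `𝒜`. -/
def nbhd (A : 𝒜) (F : Set ℕ) : Set (IsbellPsi 𝒜) := insert (ofMem A) (ofNat '' (A \ F))

theorem ofMem_mem_nbhd {A B : 𝒜} {F : Set ℕ} : ofMem B ∈ nbhd A F ↔ B = A := by
  constructor
  · rintro (h | ⟨n, -, h⟩)
    · exact ofMem_injective h
    · exact (ofNat_ne_ofMem n B h).elim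
  · rintro rfl
    exact mem_insert _ _

theorem ofNat_mem_nbhd {A : 𝒜} {n : ℕ} {F : Set ℕ} :
    (ofNat n : IsbellPsi 𝒜) ∈ nbhd A F ↔ n ∈ (A : Set ℕ) ∧ n ∉ F := by
  constructor
  · rintro (h | ⟨k, hk, h⟩)
    · exact (ofNat_ne_ofMem n A h).elim
    · rwa [← ofNat_injective h]
  · exact fun h => Or.inr ⟨n, h, rfl⟩

theorem isOpen_nbhd (A : 𝒜) {F : Set ℕ} (hF : F.Finite) : IsOpen (nbhd A F) := by
  refine isOpen_iff.2 fun B hB => hF.subset ?_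
  rw [ofMem_mem_nbhd] at hB
  subst hB
  rintro n ⟨hn, h⟩
  by_contra hnF
  exact h (ofNat_mem_nbhd.2 ⟨hn, hnF⟩)

theorem isClopen_nbhd (h : IsAlmostDisjoint 𝒜) (A : 𝒜) {F : Set ℕ} (hF : F.Finite) :
    IsClopen (nbhd A F) := by
  refine ⟨⟨isOpen_iff.2 fun B hB => ?_⟩, isOpen_nbhd A hF⟩
  have hne : (A : Set ℕ) ≠ B := fun hAB => hB (ofMem_mem_nbhd.2 (Subtype.ext hAB.symm))
  refine (h.2 A A.2 B B.2 hne).subset ?_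
  rintro n ⟨hnB, hn⟩
  exact ⟨(ofNat_mem_nbhd.1 (not_not.1 hn)).1, hnB⟩

theorem isCompact_nbhd_empty (A : 𝒜) : IsCompact (nbhd A ∅) := by
  refine isCompact_of_isCompact_diff (ofMem A) (fun U hU hAU => ⟨nbhd A ∅ \ U, ?_, Subset.rfl,
    sdiff_subset⟩) (ofMem_mem_nbhd.2 rfl)
  refine (((isOpen_iff.1 hU A hAU).image ofNat).subset ?_).isCompact
  rintro x ⟨hx, hxU⟩
  obtain ⟨n, rfl⟩ | ⟨B, rfl⟩ := eq_ofNat_or_ofMem x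
  · exact ⟨n, ⟨(ofNat_mem_nbhd.1 hx).1, hxU⟩, rfl⟩
  · rw [ofMem_mem_nbhd.1 hx] at hxU
    exact (hxU hAU).elim

theorem totallySeparatedSpace (h : IsAlmostDisjoint 𝒜) : TotallySeparatedSpace (IsbellPsi 𝒜) := by
  rw [totallySeparatedSpace_iff_exists_isClopen]
  intro x y hxy
  obtain ⟨n, rfl⟩ | ⟨A, rfl⟩ := eq_ofNat_or_ofMem x
  · exact ⟨_, isClopen_singleton_ofNat n, rfl, fun hy => hxy hy.symm⟩
  · obtain ⟨n, rfl⟩ | ⟨B, rfl⟩ := eq_ofNat_or_ofMem y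
    · exact ⟨_, isClopen_nbhd h A (finite_singleton n), ofMem_mem_nbhd.2 rfl,
        fun hn => (ofNat_mem_nbhd.1 hn).2 rfl⟩
    · exact ⟨_, isClopen_nbhd h A finite_empty, ofMem_mem_nbhd.2 rfl,
        fun hB => hxy (by rw [ofMem_mem_nbhd.1 hB])⟩

theorem weaklyLocallyCompactSpace : WeaklyLocallyCompactSpace (IsbellPsi 𝒜) := by
  refine ⟨fun x => ?_⟩
  obtain ⟨n, rfl⟩ | ⟨A, rfl⟩ := eq_ofNat_or_ofMem x
  · exact ⟨_, isCompact_singleton, (isClopen_singleton_ofNat n).isOpen.mem_nhds rfl⟩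
  · exact ⟨_, isCompact_nbhd_empty A,
      (isOpen_nbhd A finite_empty).mem_nhds (ofMem_mem_nbhd.2 rfl)⟩

theorem hasBasis_nhds_ofMem (A : 𝒜) :
    (𝓝 (ofMem A)).HasBasis (fun _ : ℕ => True) fun k => nbhd A (Iio k) := by
  refine ⟨fun N => ⟨fun hN => ?_, ?_⟩⟩
  · obtain ⟨U, hUN, hU, hAU⟩ := mem_nhds_iff.1 hN
    obtain ⟨k, hk⟩ := (isOpen_iff.1 hU A hAU).bddAbove
    refine ⟨k + 1, trivial, fun x hx => hUN ?_⟩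
    obtain ⟨n, rfl⟩ | ⟨B, rfl⟩ := eq_ofNat_or_ofMem x
    · obtain ⟨hnA, hnk⟩ := ofNat_mem_nbhd.1 hx
      by_contra hnU
      exact hnk (Nat.lt_succ_of_le (hk ⟨hnA, hnU⟩))
    · rwa [ofMem_mem_nbhd.1 hx]
  · rintro ⟨k, -, hk⟩
    exact mem_of_superset ((isOpen_nbhd A (finite_Iio k)).mem_nhds (ofMem_mem_nbhd.2 rfl)) hk

theorem firstCountableTopology : FirstCountableTopology (IsbellPsi 𝒜) := by
  refine ⟨fun x => ?_⟩
  obtain ⟨n, rfl⟩ | ⟨A, rfl⟩ := eq_ofNat_or_ofMem x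
  · rw [(isOpen_singleton_iff_nhds_eq_pure _).1 (isClopen_singleton_ofNat n).isOpen]
    infer_instance
  · exact (hasBasis_nhds_ofMem A).isCountablyGenerated

/-- Any set of points from `𝒜` is closed and can be removed at once; the countably many unwanted
integers are removed singly. -/
theorem isGδ (F : Set (IsbellPsi 𝒜)) : IsGδ F := by
  have hF : F = (ofMem '' {A : 𝒜 | ofMem A ∉ F})ᶜ ∩
      ⋂ n ∈ {n : ℕ | (ofNat n : IsbellPsi 𝒜) ∉ F}, {(ofNat n : IsbellPsi 𝒜)}ᶜ := by
    ext x
    constructor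
    · refine fun hx => ⟨?_, mem_iInter₂.2 fun n hn hxn => hn (hxn ▸ hx)⟩
      rintro ⟨A, hA, rfl⟩
      exact hA hx
    · rintro ⟨h1, h2⟩
      by_contra hx
      obtain ⟨n, rfl⟩ | ⟨A, rfl⟩ := eq_ofNat_or_ofMem x
      · exact mem_iInter₂.1 h2 n hx rfl
      · exact h1 ⟨A, hx, rfl⟩
  rw [hF]
  refine IsGδ.inter (IsOpen.isGδ (isOpen_compl_iff.2 (isClosed_of_forall_notMem ?_)))
    (IsGδ.biInter (to_countable _) fun n _ =>
      (isClopen_singleton_ofNat n).isClosed.isOpen_compl.isGδ)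
  rintro n ⟨A, -, hA⟩
  exact ofNat_ne_ofMem n A hA.symm

theorem not_compactSpace (h : 𝒜.Infinite) : ¬ CompactSpace (IsbellPsi 𝒜) := by
  intro _
  have := h.to_subtype
  have hc : IsCompact (range (ofMem : 𝒜 → IsbellPsi 𝒜)) := by
    refine (isClosed_of_forall_notMem ?_).isCompact
    rintro n ⟨A, hA⟩
    exact ofNat_ne_ofMem n A hA.symm
  obtain ⟨t, ht⟩ := hc.elim_finite_subcover (fun A : 𝒜 => nbhd A ∅)
    (fun A => isOpen_nbhd A finite_empty) (by
      rintro _ ⟨A, rfl⟩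
      exact mem_iUnion.2 ⟨A, ofMem_mem_nbhd.2 rfl⟩)
  obtain ⟨A, hA⟩ := Infinite.exists_notMem_finset t
  obtain ⟨B, hB, hAB⟩ := mem_iUnion₂.1 (ht ⟨A, rfl⟩)
  rw [ofMem_mem_nbhd.1 hAB] at hA
  exact hA hB

theorem dense_range_ofNat (h : IsAlmostDisjoint 𝒜) :
    Dense (range (ofNat : ℕ → IsbellPsi 𝒜)) := by
  intro x
  obtain ⟨n, rfl⟩ | ⟨A, rfl⟩ := eq_ofNat_or_ofMem x
  · exact subset_closure ⟨n, rfl⟩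
  · refine mem_closure_iff.2 fun U hU hA => ?_
    obtain ⟨n, hnA, hn⟩ := (h.1 A A.2).exists_notMem_finite (isOpen_iff.1 hU A hA)
    have hnU : ofNat n ∈ U := by
      by_contra hnU
      exact hn ⟨hnA, hnU⟩
    exact ⟨_, hnU, n, rfl⟩

theorem linearlyHClosed (h : Maximal IsAlmostDisjoint 𝒜) : LinearlyHClosed (IsbellPsi 𝒜) := by
  have : Nonempty (IsbellPsi 𝒜) := ⟨ofNat 0⟩
  refine linearlyHClosed_of_weaklyLindelof_of_feeblyCompact (fun 𝒰 _ hc => ?_) fun V hV hne => ?_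
  · have hU : ∀ n, ∃ U ∈ 𝒰, (ofNat n : IsbellPsi 𝒜) ∈ U := fun n => by
      have : (ofNat n : IsbellPsi 𝒜) ∈ ⋃₀ 𝒰 := hc ▸ mem_univ _
      exact this
    choose U hU hnU using hU
    refine ⟨range U, range_subset_iff.2 hU, countable_range U, (dense_range_ofNat h.1).mono ?_⟩
    rintro _ ⟨n, rfl⟩
    exact ⟨U n, ⟨n, rfl⟩, hnU n⟩
  · have hk : ∀ n, ∃ k, ofNat k ∈ V n := fun n => by
      obtain ⟨_, hk, k, rfl⟩ := (dense_range_ofNat h.1).inter_open_nonempty _ (hV n) (hne n)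
      exact ⟨k, hk⟩
    choose k hk using hk
    suffices ∃ x : IsbellPsi 𝒜, MapClusterPt x atTop fun n => ofNat (k n) by
      obtain ⟨x, hx⟩ := this
      exact ⟨x, fun N hN => (mapClusterPt_iff_frequently.1 hx N hN).mono
        fun n hn => ⟨_, hk n, hn⟩⟩
    -- An infinite set of values meets some member of `𝒜` infinitely often, and the sequence
    -- clusters at that member.
    by_cases hfin : (range k).Finite
    · obtain ⟨x, -, hx⟩ := (hfin.image (ofNat : ℕ → IsbellPsi 𝒜)).isCompact
        |>.exists_mapClusterPt_of_frequently (f := fun n => ofNat (k n)) (l := atTop)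
          (Frequently.of_forall fun n => ⟨k n, ⟨n, rfl⟩, rfl⟩)
      exact ⟨x, hx⟩
    · obtain ⟨A, hA, hAk⟩ := exists_infinite_inter_of_maximal h hfin
      refine ⟨ofMem ⟨A, hA⟩, mapClusterPt_iff_frequently.2 fun N hN =>
        frequently_atTop.2 fun M => ?_⟩
      obtain ⟨U, hUN, hU, hAU⟩ := mem_nhds_iff.1 hN
      obtain ⟨j, ⟨hjA, n, rfl⟩, hj⟩ := hAk.exists_notMem_finite
        ((isOpen_iff.1 hU _ hAU).union ((finite_Iio M).image k))
      refine ⟨n, ?_, hUN ?_⟩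
      · by_contra hn
        exact hj (Or.inr ⟨n, not_le.1 hn, rfl⟩)
      · by_contra hn
        exact hj (Or.inl ⟨hjA, hn⟩)

end IsbellPsi

end

/-! ### The five examples together -/

theorem mainTheorem5 :
    -- (a)
    (∃ (X : Type) (_ : TopologicalSpace X),
      LinearlyHClosed X ∧ ¬ CompactSpace X ∧
      FirstCountableTopology X ∧ T35Space X ∧ lindelofNumber X = ℵ₁) ∧
    -- (b)
    ((∃ 𝒜 : Set (Set ℕ), IsInfiniteMAD 𝒜) ∧
      ∀ 𝒜 : Set (Set ℕ), IsInfiniteMAD 𝒜 →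
        LinearlyHClosed (IsbellPsi 𝒜) ∧ ¬ CompactSpace (IsbellPsi 𝒜) ∧
        FirstCountableTopology (IsbellPsi 𝒜) ∧ LocallyCompactSpace (IsbellPsi 𝒜) ∧
        T35Space (IsbellPsi 𝒜) ∧ ClosedSetsAreGδ (IsbellPsi 𝒜)) ∧
    -- (c)
    (pseudointersectionNumber = ℵ₁ →
      ∃ (X : Type) (_ : TopologicalSpace X),
        LinearlyHClosed X ∧ ¬ CompactSpace X ∧
        FirstCountableTopology X ∧ LocallyCompactSpace X ∧ T4Space X) ∧
    -- (d)
    (DiamondPrinciple →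
      ∃ (X : Type) (_ : TopologicalSpace X),
        LinearlyHClosed X ∧ ¬ CompactSpace X ∧
        FirstCountableTopology X ∧ LocallyCompactSpace X ∧ T6Space X) ∧
    -- (e)
    (LinearlyHClosed (SigmaProduct (ω₁ : Ordinal.{0}).ToType) ∧
      ¬ CompactSpace (SigmaProduct (ω₁ : Ordinal.{0}).ToType) ∧
      FrechetUrysohnSpace (SigmaProduct (ω₁ : Ordinal.{0}).ToType) ∧
      CollectionwiseNormal (SigmaProduct (ω₁ : Ordinal.{0}).ToType)) := by
  obtain ⟨X, hX, h1, h2, h3, h4, h5, h6⟩ := exists_tower_space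
  refine ⟨⟨X, hX, h1, h2, h3, inferInstance, h6⟩, ?_, fun _ => ⟨X, hX, h1, h2, h3, h4, h5⟩,
    exists_ostaszewski_space, ?_⟩
  · refine ⟨exists_isInfiniteMAD, fun 𝒜 h => ?_⟩
    have := IsbellPsi.totallySeparatedSpace h.2.1
    have := IsbellPsi.weaklyLocallyCompactSpace (𝒜 := 𝒜)
    -- Local compactness and total separation give a base of clopen sets, hence complete regularity.
    have := CompletelyRegularSpace.of_isTopologicalBasis_clopens
      (loc_compact_Haus_tot_disc_of_zero_dim (H := IsbellPsi 𝒜))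
    have : T35Space (IsbellPsi 𝒜) := {}
    exact ⟨IsbellPsi.linearlyHClosed h.2, IsbellPsi.not_compactSpace h.1,
      IsbellPsi.firstCountableTopology, inferInstance, inferInstance, fun F _ => IsbellPsi.isGδ F⟩
  · have : Uncountable (ω₁ : Ordinal.{0}).ToType := inferInstanceAs (Uncountable Omega1)
    exact ⟨SigmaProduct.linearlyHClosed, SigmaProduct.not_compactSpace,
      SigmaProduct.frechetUrysohnSpace, SigmaProduct.collectionwiseNormal⟩
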